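/- For a partition $\lambda=(\lambda_1\ge\lambda_2\ge\cdots)$ of $d$ let $\chi_\lambda$ be the irreducible complex character of the symmetric group $S_d$ attached to $\lambda$ (with $\chi_{(d)}$ the trivial character), let $\dim\lambda=\chi_\lambda(e)$ be its degree, and for a conjugacy class $c$ of $S_d$ put $f_\lambda(c)=|c|\,\chi_\lambda(c)/\dim\lambda$. Let $c^{(m)}$ be the class of permutations of cycle type $(m,1^{d-m})$ in $S_d$; for $d<m$ this class is empty and $f_\lambda(c^{(m)})=0$. For $k\ge 0$ let $$p_k(\lambda)=\sum_{i=1}^{d}\Bigl(\bigl(\lambda_i-i+\tfrac12\bigr)^k-\bigl(-i+\tfrac12\bigr)^k\Bigr).$$ Then for every integer $m\ge 1$ there exists a polynomial $\phi_m(Y_1,\dots,Y_m)\in\mathbf{Q}[Y_1,\dots,Y_m]$ such that for all $d\ge 1$ and all partitions $\lambda$ of $d$, $$f_\lambda(c^{(m)})=\phi_m\bigl(p_1(\lambda),\dots,p_m(\lambda)\bigr).$$ -/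

import Mathlib

noncomputable section

namespace SymChar

/-- The left regular representation of a group `G` on its complex group algebra. -/
def regularRep (G : Type*) [Group G] : Representation ℂ G (MonoidAlgebra ℂ G) :=
  (Algebra.lmul ℂ (MonoidAlgebra ℂ G)).toMonoidHom.comp (MonoidAlgebra.of ℂ G)

/-- A tableau of shape `lam` with `d` boxes: a bijective filling of the boxes of `lam` by the `d`
elements of `Fin d`; `T k` is the box `(row, column)` that contains the entry `k`. It exists exactly
when `lam` is a partition of `d`. -/
abbrev Tableau (d : ℕ) (lam : YoungDiagram) : Type := Fin d ≃ lam.cells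

variable {d : ℕ} {lam : YoungDiagram}

/-- The permutations that keep each entry of `T` in its row. -/
def rowGroup (T : Tableau d lam) : Finset (Equiv.Perm (Fin d)) :=
  {σ | ∀ k, (T (σ k)).1.1 = (T k).1.1}

/-- The permutations that keep each entry of `T` in its column. -/
def colGroup (T : Tableau d lam) : Finset (Equiv.Perm (Fin d)) :=
  {σ | ∀ k, (T (σ k)).1.2 = (T k).1.2}

/-- The row symmetrizer `a_T`, the sum of the row group. -/
def rowSymmetrizer (T : Tableau d lam) : MonoidAlgebra ℂ (Equiv.Perm (Fin d)) :=
  ∑ p ∈ rowGroup T, MonoidAlgebra.of ℂ _ p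

/-- The column antisymmetrizer `b_T`, the signed sum of the column group. -/
def colAntisymmetrizer (T : Tableau d lam) : MonoidAlgebra ℂ (Equiv.Perm (Fin d)) :=
  ∑ q ∈ colGroup T, ((Equiv.Perm.sign q : ℤ) : ℂ) • MonoidAlgebra.of ℂ _ q

/-- The Young symmetrizer `c_T = a_T b_T`. -/
def youngSymmetrizer (T : Tableau d lam) : MonoidAlgebra ℂ (Equiv.Perm (Fin d)) :=
  rowSymmetrizer T * colAntisymmetrizer T

/-- The irreducible representation of the symmetric group attached to the partition `lam`:
the left ideal `ℂ[S_d] c_T` of the group algebra, for a tableau `T` of shape `lam`. Different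
tableaux of the same shape give isomorphic representations. -/
def spechtModule (T : Tableau d lam) : Subrepresentation (regularRep (Equiv.Perm (Fin d))) where
  toSubmodule := LinearMap.range (LinearMap.mulRight ℂ (youngSymmetrizer T))
  apply_mem_toSubmodule := by
    rintro g _ ⟨x, rfl⟩
    exact ⟨MonoidAlgebra.of ℂ _ g * x, mul_assoc _ _ _⟩

/-- The irreducible character `χ_lam`. -/
def irrChar (T : Tableau d lam) : Equiv.Perm (Fin d) → ℂ :=
  (spechtModule T).toRepresentation.character

/-- The dimension `dim lam` of the irreducible representation attached to `lam`. -/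
def irrDim (T : Tableau d lam) : ℕ :=
  Module.finrank ℂ (spechtModule T).toSubmodule

open Classical in
/-- The value `χ(c)` of a function `χ` that is constant on the set `c`
(with the value `0` on the empty set). -/
def valueOn {G : Type*} (χ : G → ℂ) (c : Set G) : ℂ :=
  if h : c.Nonempty then χ h.some else 0

/-- The value of the irreducible character on a conjugacy class is its value at any element. -/
theorem valueOn_irrChar (T : Tableau d lam) (c : Set (Equiv.Perm (Fin d)))
    (hc : ∀ σ ∈ c, ∀ τ ∈ c, IsConj σ τ) (σ : Equiv.Perm (Fin d)) (hσ : σ ∈ c) :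
    valueOn (irrChar T) c = irrChar T σ := by
  have hne : c.Nonempty := ⟨σ, hσ⟩
  rw [valueOn, dif_pos hne]
  obtain ⟨g, hg⟩ := isConj_iff.mp (hc σ hσ _ hne.some_mem)
  rw [← hg]
  exact Representation.char_conj _ _ _

/-- The central character `f_lam(c) = |c| χ_lam(c) / dim lam`. -/
def centralChar (T : Tableau d lam) (c : Set (Equiv.Perm (Fin d))) : ℂ :=
  (c.ncard : ℂ) * valueOn (irrChar T) c / (irrDim T : ℂ)

/-- The class `c^{(m)}` of the permutations of cycle type `(m, 1^{d-m})` in `S_d`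
(fixed points counted as cycles of length one). It is empty for `d < m`. -/
def cycleClass (d m : ℕ) : Set (Equiv.Perm (Fin d)) :=
  {σ | σ.partition.parts = m ::ₘ Multiset.replicate (d - m) 1}

/-- The permutations of cycle type `(m, 1^{d-m})` are conjugate to each other, so that
`valueOn (irrChar T) (cycleClass d m)` is the value of the character at any of them. -/
theorem isConj_of_mem_cycleClass {d m : ℕ} :
    ∀ σ ∈ cycleClass d m, ∀ τ ∈ cycleClass d m, IsConj σ τ := by
  intro σ hσ τ hτ
  exact Equiv.Perm.partition_eq_of_isConj.mpr (Nat.Partition.ext (hσ.trans hτ.symm))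

/-- The shifted power sum `p_k(lam) = ∑_{i=1}^d ((lam_i - i + 1/2)^k - (-i + 1/2)^k)`, where
`d` is the size of `lam`; the row with index `i` of the diagram (counted from `0`) is the part
number `i + 1` of the partition. -/
def shiftedPowerSum (k : ℕ) (lam : YoungDiagram) : ℚ :=
  ∑ i ∈ Finset.range lam.card,
    (((lam.rowLen i : ℚ) - ((i : ℚ) + 1) + 1 / 2) ^ k - (-((i : ℚ) + 1) + 1 / 2) ^ k)

end SymChar

end

/-! A central element of `ℂ[S_d]` acts on the Specht module by a scalar, so the normalized trace
`normTrace` is multiplicative on the centre. The proof evaluates it on two families of central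
elements and compares them.

Power sums of Jucys-Murphy elements give power sums of contents (column minus row). The scalar of a
central `z` is `youngCoeff T z`, the identity coefficient of `z c_T`. For a standard tableau the
entries up to `k` fill a subdiagram. Young's lemma on that subdiagram (`IsSubdiagram.sandwich`)
makes `youngCoeff` multiplicative as soon as one factor commutes with all permutations of these
entries (`IsSubdiagram.youngCoeff_mul`). Up to a constant, twice a Jucys-Murphy element is a
difference of two such factors, so its powers can be evaluated.

Pattern sums place a fixed permutation of a finite set on the entries in all ways. Their normalized
characters, seen as functions on tableaux of all sizes, multiply by a rule that does not involve
`d`: the product is the character of the disjoint union plus characters of patterns on fewer points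
(`patternChar_mul`). Sorting a Jucys-Murphy power sum by coincidences among its indices
(`contentPowerSum_eq`) gives `1/(r+1)` times the `(r+1)`-cycle pattern, plus patterns on fewer
points. Induction on the number of points then puts every pattern character on `n` points in the
rational algebra of the content power sums of exponent below `n` (`patternChar_mem_contentAlg`).

For `m ≥ 2` the central character of the class is `1/m` times the `m`-cycle pattern character.
Telescoping along rows writes `p_{k+1}` as `k+1` times the `k`-th content power sum plus lower ones,
a triangular system that can be inverted over `ℚ`. -/

noncomputable section

namespace SymChar

/-! ### Subdiagrams of a tableau and Young's lemma -/

/-- A finite set of naturals has sum at least that of an initial segment of the same size, with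
equality only for the initial segment itself. -/
theorem sum_range_card_le_sum (A : Finset ℕ) :
    ∑ i ∈ Finset.range A.card, i ≤ ∑ i ∈ A, i ∧
      (∑ i ∈ A, i = ∑ i ∈ Finset.range A.card, i → A = Finset.range A.card) := by
  induction A using Finset.induction_on_max with
  | empty => simp
  | insert m A hm ih =>
    have hmA : m ∉ A := fun h => lt_irrefl _ (hm m h)
    have hsub : A ⊆ Finset.range m := fun x hx => Finset.mem_range.mpr (hm x hx)
    have hcard : A.card ≤ m := by simpa using Finset.card_le_card hsub
    rw [Finset.card_insert_of_notMem hmA, Finset.sum_insert hmA, Finset.sum_range_succ]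
    refine ⟨by omega, fun h => ?_⟩
    have h1 : ∑ i ∈ A, i = ∑ i ∈ Finset.range A.card, i := by omega
    have h2 : m = A.card := by omega
    rw [Finset.range_add_one, ← ih.2 h1, ← h2]

/-- A finite set of naturals closed downwards is an initial segment. -/
theorem eq_range_card_of_lower (A : Finset ℕ) (h : ∀ a ∈ A, ∀ b ≤ a, b ∈ A) :
    A = Finset.range A.card := by
  refine Finset.eq_of_subset_of_card_le (fun a ha => ?_) (by simp)
  have : Finset.range (a + 1) ⊆ A := fun b hb =>
    h a ha b (by have := Finset.mem_range.mp hb; omega)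
  simpa using Finset.card_le_card this

variable {d : ℕ} {lam : YoungDiagram}

/-- The entries in `S` fill a subdiagram of the shape of `T`. -/
def IsSubdiagram (T : Tableau d lam) (S : Finset (Fin d)) : Prop :=
  ∀ x ∈ S, ∀ y, (T y).1.1 ≤ (T x).1.1 → (T y).1.2 ≤ (T x).1.2 → y ∈ S

theorem Tableau.ext_box (T : Tableau d lam) {x y : Fin d} (h1 : (T x).1.1 = (T y).1.1)
    (h2 : (T x).1.2 = (T y).1.2) : x = y :=
  T.injective (Subtype.ext (Prod.ext h1 h2))

theorem IsSubdiagram.exists_box {T : Tableau d lam} {S : Finset (Fin d)} (hS : IsSubdiagram T S)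
    {x : Fin d} (hx : x ∈ S) {i j : ℕ} (hi : i ≤ (T x).1.1) (hj : j ≤ (T x).1.2) :
    ∃ y ∈ S, (T y).1.1 = i ∧ (T y).1.2 = j := by
  have hmem : (i, j) ∈ lam.cells :=
    YoungDiagram.up_left_mem lam hi hj (T x).2
  refine ⟨T.symm ⟨(i, j), hmem⟩, hS x hx _ ?_ ?_, ?_, ?_⟩ <;> simp [hi, hj]

/-- The permutations that fix every entry outside `S`. -/
def permsOn (S : Finset (Fin d)) : Subgroup (Equiv.Perm (Fin d)) where
  carrier := {σ | ∀ k ∉ S, σ k = k}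
  mul_mem' {a b} ha hb k hk := by
    rw [Equiv.Perm.mul_apply, hb k hk, ha k hk]
  one_mem' _ _ := rfl
  inv_mem' {a} ha k hk := by
    rw [Equiv.Perm.inv_eq_iff_eq, ha k hk]

theorem permsOn_apply_mem {S : Finset (Fin d)} {σ : Equiv.Perm (Fin d)} (h : σ ∈ permsOn S)
    {x : Fin d} (hx : x ∈ S) : σ x ∈ S := by
  by_contra hn
  rw [σ.injective (h _ hn)] at hn
  exact hn hx

theorem permsOn_mono {S S' : Finset (Fin d)} (h : S ⊆ S') : permsOn S ≤ permsOn S' :=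
  fun _ hσ k hk => hσ k fun hk' => hk (h hk')

theorem permsOn_univ : permsOn (Finset.univ : Finset (Fin d)) = ⊤ :=
  eq_top_iff.mpr fun _ _ _ hk => absurd (Finset.mem_univ _) hk

theorem swap_mem_permsOn {S : Finset (Fin d)} {x y : Fin d} (hx : x ∈ S) (hy : y ∈ S) :
    Equiv.swap x y ∈ permsOn S := fun _ hk =>
  Equiv.swap_apply_of_ne_of_ne (fun h => hk (h ▸ hx)) (fun h => hk (h ▸ hy))

theorem mem_rowGroup {T : Tableau d lam} {σ : Equiv.Perm (Fin d)} :
    σ ∈ rowGroup T ↔ ∀ k, (T (σ k)).1.1 = (T k).1.1 := by simp [rowGroup]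

theorem mem_colGroup {T : Tableau d lam} {σ : Equiv.Perm (Fin d)} :
    σ ∈ colGroup T ↔ ∀ k, (T (σ k)).1.2 = (T k).1.2 := by simp [colGroup]

theorem swap_mem_rowGroup {T : Tableau d lam} {x y : Fin d} (h : (T x).1.1 = (T y).1.1) :
    Equiv.swap x y ∈ rowGroup T := by
  refine mem_rowGroup.mpr fun k => ?_
  rw [Equiv.swap_apply_def]
  split_ifs with h1 h2
  · rw [h1, h]
  · rw [h2, h]
  · rfl

theorem swap_mem_colGroup {T : Tableau d lam} {x y : Fin d} (h : (T x).1.2 = (T y).1.2) :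
    Equiv.swap x y ∈ colGroup T := by
  refine mem_colGroup.mpr fun k => ?_
  rw [Equiv.swap_apply_def]
  split_ifs with h1 h2
  · rw [h1, h]
  · rw [h2, h]
  · rfl

/-- A rearrangement of a subdiagram in which no two entries share both their old row and their new
column moves every entry within its row to a box in the prescribed column. -/
theorem IsSubdiagram.exists_box_of_injOn {T : Tableau d lam} {S : Finset (Fin d)}
    (hS : IsSubdiagram T S) {g : Equiv.Perm (Fin d)} (hg : g ∈ permsOn S)
    (h : ∀ x ∈ S, ∀ y ∈ S, (T x).1.1 = (T y).1.1 → (T (g⁻¹ x)).1.2 = (T (g⁻¹ y)).1.2 → x = y) :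
    ∀ x ∈ S, ∃ y ∈ S, (T y).1.1 = (T x).1.1 ∧ (T y).1.2 = (T (g⁻¹ x)).1.2 := by
  classical
  have hg' : g⁻¹ ∈ permsOn S := inv_mem hg
  set r : Fin d → ℕ := fun x => (T x).1.1 with hr
  set c : Fin d → ℕ := fun x => (T x).1.2 with hc
  let F : ℕ → Finset (Fin d) := fun j => S.filter fun x => c (g⁻¹ x) = j
  let F' : ℕ → Finset (Fin d) := fun j => S.filter fun x => c x = j
  have hF : ∀ j, Set.InjOn r (F j) := by
    intro j x hx y hy hxy
    simp only [F, Finset.coe_filter, Set.mem_ofPred_eq] at hx hy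
    exact h x hx.1 y hy.1 hxy (hx.2.trans hy.2.symm)
  have hF' : ∀ j, Set.InjOn r (F' j) := by
    intro j x hx y hy hxy
    simp only [F', Finset.coe_filter, Set.mem_ofPred_eq] at hx hy
    exact T.ext_box hxy (hx.2.trans hy.2.symm)
  have hcard : ∀ j, (F j).card = (F' j).card := by
    intro j
    refine Finset.card_bij (fun x _ => g⁻¹ x) ?_ ?_ ?_
    · intro x hx
      simp only [F, F', Finset.mem_filter] at hx ⊢
      exact ⟨permsOn_apply_mem hg' hx.1, hx.2⟩
    · intro x _ y _ hxy
      exact g⁻¹.injective hxy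
    · intro y hy
      simp only [F, F', Finset.mem_filter] at hy ⊢
      exact ⟨g y, ⟨permsOn_apply_mem hg hy.1, by simpa using hy.2⟩, by simp⟩
  -- The columns of a subdiagram have no gaps, so `F' j` has the least row sum possible for its
  -- size.
  have hB : ∀ j, (F' j).image r = Finset.range (F' j).card := by
    intro j
    have := eq_range_card_of_lower ((F' j).image r) (by
      intro a ha b hb
      obtain ⟨x, hx, rfl⟩ := Finset.mem_image.mp ha
      simp only [F', Finset.mem_filter] at hx
      obtain ⟨y, hy, hy1, hy2⟩ := hS.exists_box hx.1 hb le_rfl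
      exact Finset.mem_image.mpr ⟨y, Finset.mem_filter.mpr ⟨hy, hy2.trans hx.2⟩, hy1⟩)
    rwa [Finset.card_image_of_injOn (hF' j)] at this
  have hAcard : ∀ j, ((F j).image r).card = (F' j).card := fun j => by
    rw [Finset.card_image_of_injOn (hF j), hcard]
  have hle : ∀ j ∈ S.image c, ∑ i ∈ Finset.range (F' j).card, i ≤ ∑ x ∈ F j, r x := by
    intro j _
    have := (sum_range_card_le_sum ((F j).image r)).1
    rwa [hAcard, Finset.sum_image (hF j)] at this
  -- Summed over all columns, both sides add up the rows of all entries of `S`. Hence every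
  -- inequality in `hle` is an equality, and `F j` occupies exactly the rows of `F' j`.
  have hsum : ∑ j ∈ S.image c, ∑ i ∈ Finset.range (F' j).card, i
      = ∑ j ∈ S.image c, ∑ x ∈ F j, r x := by
    rw [Finset.sum_fiberwise_of_maps_to (fun x hx =>
      Finset.mem_image_of_mem c (permsOn_apply_mem hg' hx)),
      ← Finset.sum_fiberwise_of_maps_to (fun x hx => Finset.mem_image_of_mem c hx) r]
    refine Finset.sum_congr rfl fun j _ => ?_
    rw [← hB j, Finset.sum_image (hF' j)]
  intro x hx
  have hj : c (g⁻¹ x) ∈ S.image c := Finset.mem_image_of_mem c (permsOn_apply_mem hg' hx)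
  have heq := (Finset.sum_eq_sum_iff_of_le hle).mp hsum _ hj
  have hA : (F (c (g⁻¹ x))).image r = (F' (c (g⁻¹ x))).image r := by
    rw [hB, ← hAcard]
    refine (sum_range_card_le_sum _).2 ?_
    rw [hAcard, Finset.sum_image (hF _), heq]
  have hmem : r x ∈ (F (c (g⁻¹ x))).image r :=
    Finset.mem_image_of_mem r (Finset.mem_filter.mpr ⟨hx, rfl⟩)
  rw [hA] at hmem
  obtain ⟨y, hy, hyx⟩ := Finset.mem_image.mp hmem
  simp only [F', Finset.mem_filter] at hy
  exact ⟨y, hy.1, hyx, hy.2⟩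

/-- Young's lemma: a permutation of a subdiagram is a product of a row and a column permutation,
or it carries two entries of a column to two entries of a row. -/
theorem IsSubdiagram.factor_or_swap {T : Tableau d lam} {S : Finset (Fin d)}
    (hS : IsSubdiagram T S) {g : Equiv.Perm (Fin d)} (hg : g ∈ permsOn S) :
    (∃ p ∈ rowGroup T, ∃ q ∈ colGroup T, p ∈ permsOn S ∧ q ∈ permsOn S ∧ g = p * q) ∨
      ∃ x ∈ S, ∃ y ∈ S, x ≠ y ∧ (T x).1.1 = (T y).1.1 ∧ (T (g⁻¹ x)).1.2 = (T (g⁻¹ y)).1.2 := by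
  classical
  by_cases h : ∀ x ∈ S, ∀ y ∈ S, (T x).1.1 = (T y).1.1 →
      (T (g⁻¹ x)).1.2 = (T (g⁻¹ y)).1.2 → x = y
  · left
    have hg' : g⁻¹ ∈ permsOn S := inv_mem hg
    choose! f hfS hf1 hf2 using hS.exists_box_of_injOn hg h
    -- `f x` is the entry in the row of `x` and the column of `g⁻¹ x`. So `p` preserves rows, `p *
    -- g` preserves columns, and `g = p⁻¹ (p g)`.
    let p₀ : Fin d → Fin d := fun x => if x ∈ S then f x else x
    have hinj : Function.Injective p₀ := by
      intro x y hxy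
      simp only [p₀] at hxy
      split_ifs at hxy with h1 h2 h2
      · exact h x h1 y h2 (by rw [← hf1 x h1, hxy, hf1 y h2]) (by rw [← hf2 x h1, hxy, hf2 y h2])
      · exact absurd (hxy ▸ hfS x h1) h2
      · exact absurd (hxy ▸ hfS y h2) h1
      · exact hxy
    let p : Equiv.Perm (Fin d) := Equiv.ofBijective p₀ (Finite.injective_iff_bijective.mp hinj)
    have hp : ∀ x, p x = if x ∈ S then f x else x := fun x => rfl
    have hpS : p ∈ permsOn S := fun k hk => by rw [hp, if_neg hk]
    refine ⟨p⁻¹, ?_, p * g, ?_, inv_mem hpS, mul_mem hpS hg, by group⟩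
    · refine mem_rowGroup.mpr fun k => ?_
      have key : ∀ x, (T (p x)).1.1 = (T x).1.1 := by
        intro x
        rw [hp]
        split_ifs with hx
        · exact hf1 x hx
        · rfl
      rw [← key (p⁻¹ k)]
      simp
    · refine mem_colGroup.mpr fun k => ?_
      rw [Equiv.Perm.mul_apply, hp]
      split_ifs with hk
      · rw [hf2 _ hk]; simp
      · rw [hg k]
        intro hkS
        exact hk (permsOn_apply_mem hg hkS)
  · right
    push Not at h
    obtain ⟨x, hx, y, hy, h1, h2, h3⟩ := h
    exact ⟨x, hx, y, hy, h3, h1, h2⟩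

/-! ### Symmetrizers of a subdiagram in the group algebra -/

/-- The group algebra of the symmetric group. -/
abbrev SymAlg (d : ℕ) : Type := MonoidAlgebra ℂ (Equiv.Perm (Fin d))

local notation "δ" => MonoidAlgebra.of ℂ (Equiv.Perm (Fin _))

/-- The subalgebra spanned by the permutations that fix every entry outside `S`. -/
def algOn (S : Finset (Fin d)) : Subalgebra ℂ (SymAlg d) :=
  Algebra.adjoin ℂ (δ '' (permsOn S : Set (Equiv.Perm (Fin d))))

theorem of_mem_algOn {S : Finset (Fin d)} {g : Equiv.Perm (Fin d)} (hg : g ∈ permsOn S) :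
    δ g ∈ algOn S :=
  Algebra.subset_adjoin ⟨g, hg, rfl⟩

theorem algOn_mono {S S' : Finset (Fin d)} (h : S ⊆ S') : algOn S ≤ algOn S' :=
  Algebra.adjoin_mono (Set.image_mono fun _ hg => permsOn_mono h hg)

theorem mem_algOn_univ (z : SymAlg d) : z ∈ algOn (Finset.univ : Finset (Fin d)) := by
  induction z using MonoidAlgebra.induction_on with
  | of g => exact of_mem_algOn (by simp [permsOn_univ])
  | add f g hf hg => exact add_mem hf hg
  | smul r f hf => exact Subalgebra.smul_mem _ hf r

/-- The generators already form a submonoid, so the subalgebra is their linear span and no product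
case is needed. -/
theorem algOn_induction {S : Finset (Fin d)} {P : SymAlg d → Prop}
    (of : ∀ g ∈ permsOn S, P (δ g)) (zero : P 0) (add : ∀ x y, P x → P y → P (x + y))
    (smul : ∀ (r : ℂ) x, P x → P (r • x)) {z : SymAlg d} (hz : z ∈ algOn S) : P z := by
  have h1 : z ∈ Submodule.span ℂ (δ '' (permsOn S : Set (Equiv.Perm (Fin d)))) := by
    rw [← Algebra.adjoin_eq_span_of_subset]
    · exact hz
    · have : Submonoid.closure (δ '' (permsOn S : Set (Equiv.Perm (Fin d))))
          ≤ (permsOn S).toSubmonoid.map (MonoidAlgebra.of ℂ (Equiv.Perm (Fin d))) :=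
        Submonoid.closure_le.mpr fun x hx => hx
      exact fun x hx => Submodule.subset_span (this hx)
  clear hz
  induction h1 using Submodule.span_induction with
  | mem x hx => obtain ⟨g, hg, rfl⟩ := hx; exact of g hg
  | zero => exact zero
  | add x y _ _ hx hy => exact add x y hx hy
  | smul r x _ hx => exact smul r x hx

theorem commute_of_mem_algOn {S : Finset (Fin d)} {z : SymAlg d}
    (hz : ∀ g ∈ permsOn S, Commute (δ g) z) {w : SymAlg d} (hw : w ∈ algOn S) : Commute w z :=
  algOn_induction (P := fun w => Commute w z) hz (Commute.zero_left z)
    (fun _ _ => Commute.add_left) (fun r _ h => h.smul_left r) hw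

open Classical in
/-- The sum of the row group of a subdiagram. -/
def rowSymOn (T : Tableau d lam) (S : Finset (Fin d)) : SymAlg d :=
  ∑ p ∈ rowGroup T with p ∈ permsOn S, δ p

open Classical in
/-- The signed sum of the column group of a subdiagram. -/
def colAntiOn (T : Tableau d lam) (S : Finset (Fin d)) : SymAlg d :=
  ∑ q ∈ colGroup T with q ∈ permsOn S, ((Equiv.Perm.sign q : ℤ) : ℂ) • δ q

theorem rowSymOn_univ (T : Tableau d lam) : rowSymOn T Finset.univ = rowSymmetrizer T := by
  simp [rowSymOn, rowSymmetrizer, permsOn_univ]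

theorem colAntiOn_univ (T : Tableau d lam) : colAntiOn T Finset.univ = colAntisymmetrizer T := by
  simp [colAntiOn, colAntisymmetrizer, permsOn_univ]

theorem rowSymOn_mem (T : Tableau d lam) (S : Finset (Fin d)) : rowSymOn T S ∈ algOn S := by
  classical
  exact sum_mem fun _ hp => of_mem_algOn (Finset.mem_filter.mp hp).2

theorem rowSymOn_mul_of {T : Tableau d lam} {S : Finset (Fin d)} {u : Equiv.Perm (Fin d)}
    (hu : u ∈ rowGroup T) (huS : u ∈ permsOn S) : rowSymOn T S * δ u = rowSymOn T S := by
  classical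
  rw [rowSymOn, Finset.sum_mul]
  refine Finset.sum_equiv (Equiv.mulRight u) (fun p => ?_) (fun p _ => by simp)
  have h1 : p * u ∈ rowGroup T ↔ p ∈ rowGroup T := by
    rw [mem_rowGroup, mem_rowGroup]
    refine ⟨fun h k => ?_, fun h k => ?_⟩
    · have h2 := h (u⁻¹ k)
      have h3 := mem_rowGroup.mp hu (u⁻¹ k)
      rw [Equiv.Perm.mul_apply] at h2
      rw [← h3] at h2
      simpa using h2
    · rw [Equiv.Perm.mul_apply, h, mem_rowGroup.mp hu]
  have h2 : p * u ∈ permsOn S ↔ p ∈ permsOn S := Subgroup.mul_mem_cancel_right _ huS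
  simp only [Finset.mem_filter, Equiv.coe_mulRight, h1, h2]

theorem of_mul_colAntiOn {T : Tableau d lam} {S : Finset (Fin d)} {u : Equiv.Perm (Fin d)}
    (hu : u ∈ colGroup T) (huS : u ∈ permsOn S) :
    δ u * colAntiOn T S = ((Equiv.Perm.sign u : ℤ) : ℂ) • colAntiOn T S := by
  classical
  rw [colAntiOn, Finset.mul_sum, Finset.smul_sum]
  refine Finset.sum_equiv (Equiv.mulLeft u) (fun p => ?_) (fun p _ => ?_)
  · have h1 : u * p ∈ colGroup T ↔ p ∈ colGroup T := by
      simp only [mem_colGroup, Equiv.Perm.mul_apply, mem_colGroup.mp hu]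
    have h2 : u * p ∈ permsOn S ↔ p ∈ permsOn S := Subgroup.mul_mem_cancel_left _ huS
    simp only [Finset.mem_filter, Equiv.coe_mulLeft, h1, h2]
  · rw [Equiv.coe_mulLeft, Equiv.Perm.sign_mul, map_mul, mul_smul_comm, smul_smul]
    congr 1
    rw [Units.val_mul, Int.cast_mul, ← mul_assoc, ← Int.cast_mul, ← Units.val_mul]
    simp

/-- Row and column symmetrizers of a subdiagram cut every element down to a multiple of the
Young symmetrizer. -/
theorem IsSubdiagram.sandwich {T : Tableau d lam} {S : Finset (Fin d)} (hS : IsSubdiagram T S)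
    {z : SymAlg d} (hz : z ∈ algOn S) :
    ∃ μ : ℂ, rowSymOn T S * z * colAntiOn T S = μ • (rowSymOn T S * colAntiOn T S) := by
  refine algOn_induction (P := fun z => ∃ μ : ℂ, rowSymOn T S * z * colAntiOn T S =
    μ • (rowSymOn T S * colAntiOn T S)) ?_ ⟨0, by simp⟩ ?_ ?_ hz
  · intro g hg
    rcases hS.factor_or_swap hg with ⟨p, hp, q, hq, hpS, hqS, rfl⟩ | ⟨x, hx, y, hy, hxy, h1, h2⟩
    · refine ⟨((Equiv.Perm.sign q : ℤ) : ℂ), ?_⟩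
      rw [map_mul, ← mul_assoc, rowSymOn_mul_of hp hpS, mul_assoc, of_mul_colAntiOn hq hqS,
        mul_smul_comm]
    · refine ⟨0, ?_⟩
      have hg' : g⁻¹ ∈ permsOn S := inv_mem hg
      -- A row transposition inserted before `g` reappears after it as a column transposition, whose
      -- sign is `-1`. The term equals its own negative.
      have hconj : Equiv.swap x y * g = g * Equiv.swap (g⁻¹ x) (g⁻¹ y) := by
        rw [Equiv.mul_swap_eq_swap_mul]; simp
      have key : rowSymOn T S * δ g * colAntiOn T S = -(rowSymOn T S * δ g * colAntiOn T S) := by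
        conv_lhs => rw [← rowSymOn_mul_of (swap_mem_rowGroup h1) (swap_mem_permsOn hx hy)]
        rw [mul_assoc (rowSymOn T S), ← map_mul, hconj, map_mul, ← mul_assoc, mul_assoc,
          of_mul_colAntiOn (swap_mem_colGroup h2) (swap_mem_permsOn (permsOn_apply_mem hg' hx)
            (permsOn_apply_mem hg' hy)),
          Equiv.Perm.sign_swap (fun h => hxy (g⁻¹.injective h))]
        simp
      rw [zero_smul]
      have h3 : (2 : ℂ) • (rowSymOn T S * δ g * colAntiOn T S) = 0 := by
        rw [two_smul]; nth_rewrite 1 [key]; exact neg_add_cancel _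
      exact (smul_eq_zero.mp h3).resolve_left two_ne_zero
  · rintro x y ⟨μ, hμ⟩ ⟨ν, hν⟩
    exact ⟨μ + ν, by rw [mul_add, add_mul, hμ, hν, add_smul]⟩
  · rintro r x ⟨μ, hμ⟩
    exact ⟨r * μ, by rw [mul_smul_comm, smul_mul_assoc, hμ, smul_smul]⟩

/-! ### The identity coefficient of `z c_T` -/

/-- The coefficient of the identity, as a linear functional. -/
def coeffOne (d : ℕ) : SymAlg d →ₗ[ℂ] ℂ where
  toFun z := z.coeff 1
  map_add' _ _ := rfl
  map_smul' _ _ := rfl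

theorem coeffOne_of (g : Equiv.Perm (Fin d)) : coeffOne d (δ g) = if g = 1 then 1 else 0 := by
  classical
  change (MonoidAlgebra.single g (1 : ℂ)).coeff 1 = _
  rw [MonoidAlgebra.coeff_single, Finsupp.single_apply]

/-- The coefficient of the identity in the product of an element with the Young symmetrizer. -/
def youngCoeff (T : Tableau d lam) : SymAlg d →ₗ[ℂ] ℂ :=
  coeffOne d ∘ₗ LinearMap.mulRight ℂ (youngSymmetrizer T)

open Classical in
theorem coeffOne_of_mul_symOn (T : Tableau d lam) (S : Finset (Fin d)) (g : Equiv.Perm (Fin d)) :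
    coeffOne d (δ g * (rowSymOn T S * colAntiOn T S)) =
      ∑ pq ∈ (rowGroup T ×ˢ colGroup T) with (pq.1 ∈ permsOn S ∧ pq.2 ∈ permsOn S),
        if g * pq.1 * pq.2 = 1 then ((Equiv.Perm.sign pq.2 : ℤ) : ℂ) else 0 := by
  rw [Finset.filter_product, Finset.sum_product, rowSymOn, colAntiOn, Finset.sum_mul_sum,
    Finset.mul_sum, map_sum]
  refine Finset.sum_congr rfl fun p _ => ?_
  rw [Finset.mul_sum, map_sum]
  refine Finset.sum_congr rfl fun q _ => ?_
  rw [mul_smul_comm, mul_smul_comm, map_smul, ← mul_assoc, ← map_mul, ← map_mul, coeffOne_of]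
  simp

/-- If the product of a row and a column permutation fixes an entry, both factors do. -/
theorem fixed_of_mul_fixed {T : Tableau d lam} {p q : Equiv.Perm (Fin d)} (hp : p ∈ rowGroup T)
    (hq : q ∈ colGroup T) {k : Fin d} (h : p (q k) = k) : q k = k ∧ p k = k := by
  have hqk : q k = k := by
    refine T.ext_box ?_ (mem_colGroup.mp hq k)
    rw [← mem_rowGroup.mp hp (q k), h]
  exact ⟨hqk, by rwa [hqk] at h⟩

/-- If `g p q = 1` and `g` fixes everything outside `S`, so does `p q`, and by `fixed_of_mul_fixed`
so do `p` and `q`. The other terms of `c_T` contribute nothing. `S` need not be a subdiagram. -/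
theorem youngCoeff_eq_of_mem (T : Tableau d lam) {S : Finset (Fin d)} {z : SymAlg d}
    (hz : z ∈ algOn S) :
    youngCoeff T z = coeffOne d (z * (rowSymOn T S * colAntiOn T S)) := by
  classical
  refine algOn_induction (P := fun z => youngCoeff T z =
    coeffOne d (z * (rowSymOn T S * colAntiOn T S))) ?_ (by simp) ?_ ?_ hz
  · intro g hg
    have h0 : youngCoeff T (δ g) =
        coeffOne d (δ g * (rowSymOn T Finset.univ * colAntiOn T Finset.univ)) := by
      rw [rowSymOn_univ, colAntiOn_univ]; rfl
    rw [h0, coeffOne_of_mul_symOn, coeffOne_of_mul_symOn]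
    symm
    refine Finset.sum_subset (fun pq h => ?_) (fun pq h h' => ?_)
    · simp only [Finset.mem_filter, permsOn_univ, Subgroup.mem_top, and_self, and_true] at h ⊢
      exact h.1
    · simp only [Finset.mem_filter, permsOn_univ, Subgroup.mem_top, and_self, and_true] at h h'
      refine if_neg fun h1 => h' ⟨h, ?_⟩
      obtain ⟨hp, hq⟩ := Finset.mem_product.mp h
      have h2 : ∀ k ∉ S, pq.1 (pq.2 k) = k := by
        intro k hk
        have h3 : pq.1 * pq.2 = g⁻¹ := eq_inv_of_mul_eq_one_right (by rw [← mul_assoc, h1])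
        have h4 := inv_mem hg k hk
        rw [← h3] at h4
        exact h4
      exact ⟨fun k hk => (fixed_of_mul_fixed hp hq (h2 k hk)).2,
        fun k hk => (fixed_of_mul_fixed hp hq (h2 k hk)).1⟩
  · intro x y hx hy
    rw [map_add, hx, hy, add_mul, map_add]
  · intro r x hx
    rw [map_smul, hx, smul_mul_assoc, map_smul]

theorem youngCoeff_one (T : Tableau d lam) : youngCoeff T 1 = 1 := by
  classical
  have h1 : (1 : SymAlg d) ∈ algOn (∅ : Finset (Fin d)) := one_mem _
  have hS : ∀ g : Equiv.Perm (Fin d), g ∈ permsOn (∅ : Finset (Fin d)) ↔ g = 1 := fun g =>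
    ⟨fun h => Equiv.ext fun k => h k (by simp), fun h => h ▸ one_mem _⟩
  rw [youngCoeff_eq_of_mem T h1]
  have hr : rowSymOn T ∅ = 1 := by
    rw [rowSymOn, Finset.sum_eq_single 1] <;> simp +contextual [hS, mem_rowGroup, MonoidAlgebra.one_def]
  have hc : colAntiOn T ∅ = 1 := by
    rw [colAntiOn, Finset.sum_eq_single 1] <;> simp +contextual [hS, mem_colGroup, MonoidAlgebra.one_def]
  rw [hr, hc, mul_one, mul_one, ← map_one (MonoidAlgebra.of ℂ (Equiv.Perm (Fin d))), coeffOne_of,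
    if_pos rfl]

/-- With `a`, `b` the symmetrizers of `S`, commutation and the sandwich property give `z a b = a z b
= μ a b`. Multiplying by `w` and reading off the identity coefficient gives the factor `μ`; the case
`w = 1` identifies it. -/
theorem IsSubdiagram.youngCoeff_mul {T : Tableau d lam} {S : Finset (Fin d)}
    (hS : IsSubdiagram T S) {z w : SymAlg d} (hz : z ∈ algOn S)
    (hcomm : ∀ g ∈ permsOn S, Commute (δ g) z) (hw : w ∈ algOn S) :
    youngCoeff T (z * w) = youngCoeff T z * youngCoeff T w := by
  obtain ⟨μ, hμ⟩ := hS.sandwich hz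
  have key : ∀ w ∈ algOn S, youngCoeff T (z * w) = μ * youngCoeff T w := by
    intro w hw
    rw [youngCoeff_eq_of_mem T (mul_mem hz hw), youngCoeff_eq_of_mem T hw,
      ← (commute_of_mem_algOn hcomm hw).eq, mul_assoc w z, ← mul_assoc z,
      ← (commute_of_mem_algOn hcomm (rowSymOn_mem T S)).eq, hμ, mul_smul_comm, map_smul,
      smul_eq_mul]
  have h1 := key 1 (one_mem _)
  rw [mul_one, youngCoeff_one, mul_one] at h1
  rw [key w hw, h1]

theorem isSubdiagram_univ (T : Tableau d lam) : IsSubdiagram T Finset.univ :=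
  fun _ _ _ _ _ => Finset.mem_univ _

/-- A central element of the group algebra acts on the Young symmetrizer by a scalar. -/
theorem mul_youngSymmetrizer_of_central (T : Tableau d lam) {z : SymAlg d}
    (hz : ∀ g : Equiv.Perm (Fin d), Commute (δ g) z) :
    z * youngSymmetrizer T = youngCoeff T z • youngSymmetrizer T := by
  obtain ⟨μ, hμ⟩ := (isSubdiagram_univ T).sandwich (mem_algOn_univ z)
  have hr := (commute_of_mem_algOn (fun g _ => hz g) (rowSymOn_mem T Finset.univ)).eq
  rw [hr, rowSymOn_univ, colAntiOn_univ, mul_assoc] at hμ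
  change z * youngSymmetrizer T = μ • youngSymmetrizer T at hμ
  have h1 : youngCoeff T z = μ := by
    have h2 : youngCoeff T z = coeffOne d (z * youngSymmetrizer T) := rfl
    have h3 : coeffOne d (youngSymmetrizer T) = 1 := by
      rw [← one_mul (youngSymmetrizer T)]; exact youngCoeff_one T
    rw [h2, hμ, map_smul, h3, smul_eq_mul, mul_one]
  rw [hμ, h1]

theorem mem_permsOn_pair {x y : Fin d} {σ : Equiv.Perm (Fin d)} :
    σ ∈ permsOn ({x, y} : Finset (Fin d)) ↔ σ = 1 ∨ σ = Equiv.swap x y := by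
  constructor
  · intro h
    have hx : σ x ∈ ({x, y} : Finset (Fin d)) := permsOn_apply_mem h (by simp)
    have hy : σ y ∈ ({x, y} : Finset (Fin d)) := permsOn_apply_mem h (by simp)
    simp only [Finset.mem_insert, Finset.mem_singleton] at hx hy
    by_cases hxy : x = y
    · left
      subst hxy
      ext k
      by_cases hk : k = x
      · subst hk; simp_all
      · rw [h k (by simp [hk])]; rfl
    rcases hx with hx | hx
    · left
      have hy' : σ y = y := hy.resolve_left fun h' => hxy (σ.injective (hx.trans h'.symm))
      ext k
      by_cases hk : k ∈ ({x, y} : Finset (Fin d))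
      · simp only [Finset.mem_insert, Finset.mem_singleton] at hk
        rcases hk with rfl | rfl <;> simp [*]
      · rw [h k hk]; rfl
    · right
      have hy' : σ y = x := hy.resolve_right fun h' => hxy (σ.injective (hx.trans h'.symm))
      ext k
      by_cases hk : k ∈ ({x, y} : Finset (Fin d))
      · simp only [Finset.mem_insert, Finset.mem_singleton] at hk
        rcases hk with rfl | rfl <;> simp [*]
      · rw [h k hk]
        simp only [Finset.mem_insert, Finset.mem_singleton, not_or] at hk
        rw [Equiv.swap_apply_of_ne_of_ne hk.1 hk.2]
  · rintro (rfl | rfl)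
    · exact one_mem _
    · exact swap_mem_permsOn (by simp) (by simp)

theorem swap_mem_rowGroup_iff {T : Tableau d lam} {x y : Fin d} :
    Equiv.swap x y ∈ rowGroup T ↔ (T x).1.1 = (T y).1.1 :=
  ⟨fun h => by simpa using (mem_rowGroup.mp h x).symm, swap_mem_rowGroup⟩

theorem swap_mem_colGroup_iff {T : Tableau d lam} {x y : Fin d} :
    Equiv.swap x y ∈ colGroup T ↔ (T x).1.2 = (T y).1.2 :=
  ⟨fun h => by simpa using (mem_colGroup.mp h x).symm, swap_mem_colGroup⟩

theorem one_mem_rowGroup (T : Tableau d lam) : 1 ∈ rowGroup T := mem_rowGroup.mpr fun _ => rfl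

theorem one_mem_colGroup (T : Tableau d lam) : 1 ∈ colGroup T := mem_colGroup.mpr fun _ => rfl

/-- The coefficients of the transpositions in a Young symmetrizer. -/
theorem youngCoeff_swap (T : Tableau d lam) {x y : Fin d} (hxy : x ≠ y) :
    youngCoeff T (δ (Equiv.swap x y)) =
      (if (T x).1.1 = (T y).1.1 then 1 else 0) - (if (T x).1.2 = (T y).1.2 then 1 else 0) := by
  classical
  set s := Equiv.swap x y with hs
  have hs1 : s ≠ 1 := fun h => hxy (by
    have := congrArg (fun σ : Equiv.Perm (Fin d) => σ y) h
    simpa [hs] using this)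
  have hss : δ s * δ s = (1 : SymAlg d) := by rw [← map_mul, hs, Equiv.swap_mul_self, map_one]
  have hrow : rowSymOn T {x, y} = 1 + (if (T x).1.1 = (T y).1.1 then (1 : ℂ) else 0) • δ s := by
    have : (rowGroup T).filter (· ∈ permsOn {x, y}) =
        if (T x).1.1 = (T y).1.1 then {1, s} else {1} := by
      ext σ
      rw [Finset.mem_filter, mem_permsOn_pair]
      split_ifs with h
      · rw [← hs, Finset.mem_insert, Finset.mem_singleton, and_iff_right_iff_imp]
        rintro (rfl | rfl)
        exacts [one_mem_rowGroup T, swap_mem_rowGroup_iff.mpr h]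
      · simp only [Finset.mem_singleton]
        refine ⟨?_, by rintro rfl; exact ⟨one_mem_rowGroup T, Or.inl rfl⟩⟩
        rintro ⟨h1, rfl | rfl⟩
        exacts [rfl, absurd (swap_mem_rowGroup_iff.mp h1) h]
    rw [rowSymOn, this]
    split_ifs
    · rw [Finset.sum_pair hs1.symm, map_one, one_smul]
    · rw [Finset.sum_singleton, map_one, zero_smul, add_zero]
  have hcol : colAntiOn T {x, y} = 1 - (if (T x).1.2 = (T y).1.2 then (1 : ℂ) else 0) • δ s := by
    have : (colGroup T).filter (· ∈ permsOn {x, y}) =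
        if (T x).1.2 = (T y).1.2 then {1, s} else {1} := by
      ext σ
      rw [Finset.mem_filter, mem_permsOn_pair]
      split_ifs with h
      · rw [← hs, Finset.mem_insert, Finset.mem_singleton, and_iff_right_iff_imp]
        rintro (rfl | rfl)
        exacts [one_mem_colGroup T, swap_mem_colGroup_iff.mpr h]
      · simp only [Finset.mem_singleton]
        refine ⟨?_, by rintro rfl; exact ⟨one_mem_colGroup T, Or.inl rfl⟩⟩
        rintro ⟨h1, rfl | rfl⟩
        exacts [rfl, absurd (swap_mem_colGroup_iff.mp h1) h]
    rw [colAntiOn, this]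
    split_ifs
    · rw [Finset.sum_pair hs1.symm, hs, Equiv.Perm.sign_swap hxy]
      simp [sub_eq_add_neg, MonoidAlgebra.one_def]
    · rw [Finset.sum_singleton]
      simp [MonoidAlgebra.one_def]
  have h1 : coeffOne d 1 = 1 := by
    rw [← map_one (MonoidAlgebra.of ℂ (Equiv.Perm (Fin d))), coeffOne_of, if_pos rfl]
  have h2 : coeffOne d (δ s) = 0 := by rw [coeffOne_of, if_neg hs1]
  -- Localizing to `S = {x, y}` leaves only the identity coefficient of `s (1 + a s)(1 - b s)`.
  rw [youngCoeff_eq_of_mem T (of_mem_algOn (swap_mem_permsOn (S := {x, y}) (by simp) (by simp))),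
    hrow, hcol, ← hs]
  generalize (if (T x).1.1 = (T y).1.1 then (1 : ℂ) else 0) = a
  generalize (if (T x).1.2 = (T y).1.2 then (1 : ℂ) else 0) = b
  have h3 : δ s * ((1 + a • δ s) * (1 - b • δ s)) = (1 - a * b) • δ s + (a - b) • 1 := by
    rw [mul_sub, mul_one, add_mul, one_mul, smul_mul_smul_comm, hss, mul_sub, mul_add, mul_add,
      mul_one, mul_smul_comm, mul_smul_comm, mul_smul_comm, hss, mul_one]
    module
  rw [h3, map_add, map_smul, map_smul, h1, h2]
  simp

/-! ### Jucys-Murphy elements and contents -/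

/-- The Jucys-Murphy elements. -/
def jucysMurphy (k : Fin d) : SymAlg d := ∑ i ∈ Finset.Iio k, δ (Equiv.swap i k)

/-- The power sums of the Jucys-Murphy elements. -/
def jmPowerSum (d r : ℕ) : SymAlg d := ∑ k : Fin d, jucysMurphy k ^ r

theorem of_mul_swap (g : Equiv.Perm (Fin d)) (i j : Fin d) :
    δ g * δ (Equiv.swap i j) = δ (Equiv.swap (g i) (g j)) * δ g := by
  rw [← map_mul, ← map_mul, Equiv.mul_swap_eq_swap_mul]

theorem commute_jucysMurphy {k : Fin d} {g : Equiv.Perm (Fin d)} (hk : g k = k)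
    (hg : ∀ i, g i < k ↔ i < k) : Commute (δ g) (jucysMurphy k) := by
  rw [commute_iff_eq, jucysMurphy, Finset.mul_sum, Finset.sum_mul]
  refine Finset.sum_equiv g (fun i => by simp [hg]) (fun i _ => ?_)
  rw [of_mul_swap, hk]

theorem commute_jucysMurphy_of_lt {k : Fin d} {g : Equiv.Perm (Fin d)}
    (hg : g ∈ permsOn (Finset.Iio k)) : Commute (δ g) (jucysMurphy k) := by
  refine commute_jucysMurphy (hg k (by simp)) fun i => ⟨fun h => ?_, fun h => ?_⟩
  · by_contra hi
    rw [hg i (by simpa using hi)] at h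
    exact hi h
  · simpa using permsOn_apply_mem hg (x := i) (by simpa using h)

/-- The sum of all transpositions of two entries of `S`, with repetitions. -/
def swapSum (S : Finset (Fin d)) : SymAlg d := ∑ i ∈ S, ∑ j ∈ S, δ (Equiv.swap i j)

theorem commute_swapSum {S : Finset (Fin d)} {g : Equiv.Perm (Fin d)} (hg : g ∈ permsOn S) :
    Commute (δ g) (swapSum S) := by
  have hS : ∀ i, i ∈ S ↔ g i ∈ S := fun i =>
    ⟨permsOn_apply_mem hg, fun h => by simpa using permsOn_apply_mem (inv_mem hg) h⟩
  rw [commute_iff_eq, swapSum, Finset.mul_sum, Finset.sum_mul]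
  refine Finset.sum_equiv g hS (fun i _ => ?_)
  rw [Finset.mul_sum, Finset.sum_mul]
  exact Finset.sum_equiv g hS (fun j _ => of_mul_swap g i j)

theorem swapSum_mem (S : Finset (Fin d)) : swapSum S ∈ algOn S :=
  sum_mem fun _ hi => sum_mem fun _ hj => of_mem_algOn (swap_mem_permsOn hi hj)

/-- `swapSum` runs over ordered pairs: those with exactly one member `k` give each transposition
twice, and the pair `(k, k)` gives the final `1`. -/
theorem swapSum_Iic (k : Fin d) :
    swapSum (Finset.Iic k) = swapSum (Finset.Iio k) + (2 : ℂ) • jucysMurphy k + 1 := by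
  rw [← Finset.Iio_insert, swapSum, Finset.sum_insert (by simp), Finset.sum_insert (by simp)]
  have h1 : ∀ i ∈ Finset.Iio k, ∑ j ∈ insert k (Finset.Iio k), δ (Equiv.swap i j) =
      δ (Equiv.swap i k) + ∑ j ∈ Finset.Iio k, δ (Equiv.swap i j) := fun i _ =>
    Finset.sum_insert (by simp)
  rw [Finset.sum_congr rfl h1, Finset.sum_add_distrib, Equiv.swap_self, jucysMurphy, two_smul,
    swapSum]
  have h2 : δ (Equiv.refl (Fin d)) = (1 : SymAlg d) := map_one _
  rw [h2, Finset.sum_congr rfl fun j _ => by rw [Equiv.swap_comm k j]]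
  abel

theorem jucysMurphy_mem (k : Fin d) : jucysMurphy k ∈ algOn (Finset.Iic k) :=
  sum_mem fun i hi => of_mem_algOn (swap_mem_permsOn
    (Finset.mem_Iic.mpr (Finset.mem_Iio.mp hi).le) (by simp))

/-- The entries increase along rows and columns. -/
def IsStandard (T : Tableau d lam) : Prop :=
  ∀ x y, (T x).1.1 ≤ (T y).1.1 → (T x).1.2 ≤ (T y).1.2 → x ≤ y

theorem IsStandard.isSubdiagram_Iic {T : Tableau d lam} (hT : IsStandard T) (k : Fin d) :
    IsSubdiagram T (Finset.Iic k) := fun x hx y h1 h2 => by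
  rw [Finset.mem_Iic] at hx ⊢
  exact (hT y x h1 h2).trans hx

theorem IsStandard.isSubdiagram_Iio {T : Tableau d lam} (hT : IsStandard T) (k : Fin d) :
    IsSubdiagram T (Finset.Iio k) := fun x hx y h1 h2 => by
  rw [Finset.mem_Iio] at hx ⊢
  exact (hT y x h1 h2).trans_lt hx

/-- Write `2 X_k` as a difference of two swap sums minus `1`. The sum over `Iic k` splits off by
`youngCoeff_mul`; the sum over `Iio k` commutes with `X_k ^ r` and is absorbed into `u`, so the
induction needs an arbitrary `u`. -/
theorem IsStandard.youngCoeff_jucysMurphy_pow_mul {T : Tableau d lam} (hT : IsStandard T)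
    (k : Fin d) (r : ℕ) : ∀ u ∈ algOn (Finset.Iio k),
      youngCoeff T (jucysMurphy k ^ r * u) = youngCoeff T (jucysMurphy k) ^ r * youngCoeff T u := by
  induction r with
  | zero => intro u _; simp
  | succ r ih =>
    intro u hu
    have hmono : algOn (Finset.Iio k) ≤ algOn (Finset.Iic k) := algOn_mono Finset.Iio_subset_Iic_self
    have hle := swapSum_mem (Finset.Iic k)
    have hlt := swapSum_mem (Finset.Iio k)
    have hX : (2 : ℂ) • jucysMurphy k =
        swapSum (Finset.Iic k) - swapSum (Finset.Iio k) - 1 := by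
      rw [swapSum_Iic]; abel
    have hXr : Commute (swapSum (Finset.Iio k)) (jucysMurphy k ^ r) :=
      (commute_of_mem_algOn (fun g hg => commute_jucysMurphy_of_lt hg) hlt).pow_right r
    have h1 : (2 : ℂ) • (jucysMurphy k ^ (r + 1) * u) =
        swapSum (Finset.Iic k) * (jucysMurphy k ^ r * u)
          - jucysMurphy k ^ r * (swapSum (Finset.Iio k) * u) - jucysMurphy k ^ r * u := by
      rw [pow_succ', mul_assoc, ← smul_mul_assoc, hX, sub_mul, sub_mul, one_mul,
        ← mul_assoc (swapSum (Finset.Iio k)), hXr.eq, mul_assoc]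
    have h2 := congrArg (youngCoeff T) h1
    have h3 := congrArg (youngCoeff T) hX
    rw [map_smul, map_sub, map_sub, ih u hu, ih _ (mul_mem hlt hu),
      (hT.isSubdiagram_Iic k).youngCoeff_mul hle (fun g hg => commute_swapSum hg)
        (mul_mem (pow_mem (jucysMurphy_mem k) r) (hmono hu)), ih u hu,
      (hT.isSubdiagram_Iio k).youngCoeff_mul hlt (fun g hg => commute_swapSum hg) hu,
      smul_eq_mul] at h2
    rw [map_smul, map_sub, map_sub, youngCoeff_one, smul_eq_mul] at h3
    have h4 : (2 : ℂ) * youngCoeff T (jucysMurphy k ^ (r + 1) * u) =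
        2 * (youngCoeff T (jucysMurphy k) ^ (r + 1) * youngCoeff T u) := by
      rw [h2]
      linear_combination (-(youngCoeff T (jucysMurphy k) ^ r * youngCoeff T u)) * h3
    exact mul_left_cancel₀ two_ne_zero h4

/-- An earlier entry counts `+1` in the row of `k` and `-1` in its column. By standardness these are
exactly the boxes to the left of and above the box of `k`. -/
theorem IsStandard.youngCoeff_jucysMurphy {T : Tableau d lam} (hT : IsStandard T) (k : Fin d) :
    youngCoeff T (jucysMurphy k) = ((T k).1.2 : ℂ) - ((T k).1.1 : ℂ) := by
  have hlt : ∀ i, i < k ↔ i ≤ k ∧ i ≠ k := fun i => lt_iff_le_and_ne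
  have hrow : ((Finset.Iio k).filter fun i => (T i).1.1 = (T k).1.1).card = (T k).1.2 := by
    rw [← Finset.card_range (T k).1.2]
    refine Finset.card_bij (fun i _ => (T i).1.2) ?_ ?_ ?_
    · intro i hi
      simp only [Finset.mem_filter, Finset.mem_Iio] at hi
      rw [Finset.mem_range]
      by_contra hn
      exact absurd (hT k i hi.2.ge (not_lt.mp hn)) (not_le.mpr hi.1)
    · intro i hi j hj hij
      simp only [Finset.mem_filter] at hi hj
      exact T.ext_box (hi.2.trans hj.2.symm) hij
    · intro c hc
      rw [Finset.mem_range] at hc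
      obtain ⟨y, -, h1, h2⟩ := (isSubdiagram_univ T).exists_box (Finset.mem_univ k) le_rfl hc.le
      refine ⟨y, ?_, h2⟩
      rw [Finset.mem_filter, Finset.mem_Iio, hlt]
      exact ⟨⟨hT y k h1.le (h2.trans_le hc.le), by rintro rfl; omega⟩, h1⟩
  have hcol : ((Finset.Iio k).filter fun i => (T i).1.2 = (T k).1.2).card = (T k).1.1 := by
    rw [← Finset.card_range (T k).1.1]
    refine Finset.card_bij (fun i _ => (T i).1.1) ?_ ?_ ?_
    · intro i hi
      simp only [Finset.mem_filter, Finset.mem_Iio] at hi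
      rw [Finset.mem_range]
      by_contra hn
      exact absurd (hT k i (not_lt.mp hn) hi.2.ge) (not_le.mpr hi.1)
    · intro i hi j hj hij
      simp only [Finset.mem_filter] at hi hj
      exact T.ext_box hij (hi.2.trans hj.2.symm)
    · intro c hc
      rw [Finset.mem_range] at hc
      obtain ⟨y, -, h1, h2⟩ := (isSubdiagram_univ T).exists_box (Finset.mem_univ k) hc.le le_rfl
      refine ⟨y, ?_, h1⟩
      rw [Finset.mem_filter, Finset.mem_Iio, hlt]
      exact ⟨⟨hT y k (h1.trans_le hc.le) h2.le, by rintro rfl; omega⟩, h2⟩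
  rw [jucysMurphy, map_sum, Finset.sum_congr rfl fun i hi =>
    youngCoeff_swap T (Finset.mem_Iio.mp hi).ne, Finset.sum_sub_distrib, Finset.sum_boole,
    Finset.sum_boole, hrow, hcol]

theorem IsStandard.youngCoeff_jmPowerSum {T : Tableau d lam} (hT : IsStandard T) (r : ℕ) :
    youngCoeff T (jmPowerSum d r) = ∑ x ∈ lam.cells, ((x.2 : ℂ) - (x.1 : ℂ)) ^ r := by
  rw [jmPowerSum, map_sum, ← Finset.sum_coe_sort lam.cells]
  refine Fintype.sum_equiv T _ _ fun k => ?_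
  have := hT.youngCoeff_jucysMurphy_pow_mul k r 1 (one_mem _)
  rw [mul_one, youngCoeff_one, mul_one] at this
  rw [this, hT.youngCoeff_jucysMurphy]

/-! ### Independence of the tableau -/

/-- Number the boxes in lexicographic order, which extends the product order. -/
theorem exists_isStandard (T : Tableau d lam) : ∃ g : Equiv.Perm (Fin d),
    IsStandard (d := d) (lam := lam) (g.trans T) := by
  let e : Fin d ↪ ℕ ×ₗ ℕ := ⟨fun k => toLex (T k).1, fun x y h => T.injective (Subtype.ext h)⟩
  let s : Finset (ℕ ×ₗ ℕ) := Finset.univ.map e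
  have hs : s.card = d := by simp [s]
  have hmem : ∀ k : Fin d, ∃ x, e x = s.orderEmbOfFin hs k := fun k => by
    obtain ⟨x, -, hx⟩ := Finset.mem_map.mp (s.orderEmbOfFin_mem hs k)
    exact ⟨x, hx⟩
  choose f hf using hmem
  have hinj : Function.Injective f := fun x y h =>
    (s.orderEmbOfFin hs).injective (by rw [← hf, ← hf, h])
  refine ⟨Equiv.ofBijective f (Finite.injective_iff_bijective.mp hinj), fun x y h1 h2 => ?_⟩
  rw [← (s.orderEmbOfFin hs).le_iff_le, ← hf, ← hf]
  exact Prod.Lex.toLex_mono (show (T (f x)).1 ≤ (T (f y)).1 from ⟨h1, h2⟩)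

theorem youngSymmetrizer_trans (T : Tableau d lam) (g : Equiv.Perm (Fin d)) :
    δ g * youngSymmetrizer (d := d) (lam := lam) (g.trans T) = youngSymmetrizer T * δ g := by
  have hr : δ g * rowSymmetrizer (d := d) (lam := lam) (g.trans T) = rowSymmetrizer T * δ g := by
    rw [rowSymmetrizer, rowSymmetrizer, Finset.mul_sum, Finset.sum_mul]
    refine Finset.sum_equiv (MulAut.conj g).toEquiv (fun p => ?_) (fun p _ => ?_)
    · rw [mem_rowGroup, mem_rowGroup]
      exact ⟨fun h k => by simpa using h (g⁻¹ k), fun h k => by simpa using h (g k)⟩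
    · rw [← map_mul, ← map_mul]; simp
  have hc : δ g * colAntisymmetrizer (d := d) (lam := lam) (g.trans T) =
      colAntisymmetrizer T * δ g := by
    rw [colAntisymmetrizer, colAntisymmetrizer, Finset.mul_sum, Finset.sum_mul]
    refine Finset.sum_equiv (MulAut.conj g).toEquiv (fun p => ?_) (fun p _ => ?_)
    · rw [mem_colGroup, mem_colGroup]
      exact ⟨fun h k => by simpa using h (g⁻¹ k), fun h k => by simpa using h (g k)⟩
    · have hsign : Equiv.Perm.sign ((MulAut.conj g).toEquiv p) = Equiv.Perm.sign p := by
        change Equiv.Perm.sign (g * p * g⁻¹) = _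
        rw [map_mul, map_mul, mul_right_comm, ← map_mul, mul_inv_cancel, map_one, one_mul]
      rw [hsign, mul_smul_comm, smul_mul_assoc, ← map_mul, ← map_mul]; simp
  rw [youngSymmetrizer, ← mul_assoc, hr, mul_assoc, hc, ← mul_assoc, youngSymmetrizer]

/-- Relabelling conjugates the Young symmetrizer, and a central `z` has the same eigenvalue on both
conjugates. -/
theorem youngCoeff_trans (T : Tableau d lam) (g : Equiv.Perm (Fin d)) {z : SymAlg d}
    (hz : ∀ g : Equiv.Perm (Fin d), Commute (δ g) z) :
    youngCoeff (d := d) (lam := lam) (g.trans T) z = youngCoeff T z := by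
  have h1 := mul_youngSymmetrizer_of_central (d := d) (lam := lam) (g.trans T) hz
  have h2 := mul_youngSymmetrizer_of_central T hz
  have h3 := congrArg (fun w => δ g * w) h1
  beta_reduce at h3
  rw [← mul_assoc, (hz g).eq, mul_assoc, mul_smul_comm, youngSymmetrizer_trans, ← mul_assoc, h2,
    ← smul_mul_assoc] at h3
  have h4 := congrArg (· * δ g⁻¹) h3
  simp only [mul_assoc, ← map_mul, mul_inv_cancel, map_one, mul_one] at h4
  have h5 := congrArg (coeffOne d) h4
  have h6 : coeffOne d (youngSymmetrizer T) = 1 := by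
    rw [← one_mul (youngSymmetrizer T)]; exact youngCoeff_one T
  rw [map_smul, map_smul, h6] at h5
  simpa using h5.symm

/-! ### Centrality of the Jucys-Murphy power sums -/

/-- The corrections `∓1` cancel in `x + y` and in `x y`, so `s` commutes with both, and Newton's
two-term recursion reaches all power sums. -/
theorem commute_pow_add_pow {R : Type*} [Ring R] {s x y : R} (h1 : s * x = y * s - 1)
    (h2 : s * y = x * s + 1) (hxy : Commute x y) (r : ℕ) : Commute s (x ^ r + y ^ r) := by
  have he1 : Commute s (x + y) := by
    rw [commute_iff_eq, mul_add, h1, h2, add_mul]; abel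
  have he2 : Commute s (x * y) := by
    rw [commute_iff_eq, ← mul_assoc, h1, sub_mul, mul_assoc, h2, mul_add, hxy.eq]
    noncomm_ring
  induction r using Nat.twoStepInduction with
  | zero => simp
  | one => simpa using he1
  | more r ih1 ih2 =>
    have : x ^ (r + 2) + y ^ (r + 2) =
        (x + y) * (x ^ (r + 1) + y ^ (r + 1)) - x * y * (x ^ r + y ^ r) := by
      have h3 : x * y * x ^ r = y * x ^ (r + 1) := by rw [hxy.eq, mul_assoc, ← pow_succ']
      rw [mul_add (x * y), h3, mul_assoc x y, ← pow_succ', add_mul, mul_add, mul_add, ← pow_succ',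
        ← pow_succ']
      abel
    rw [this]
    exact (he1.mul_right ih2).sub_right (he2.mul_right ih1)

/-- The element with the smaller index lies in the algebra of the entries below the larger index,
with which the other one commutes. -/
theorem commute_jucysMurphy_jucysMurphy (a b : Fin d) :
    Commute (jucysMurphy a) (jucysMurphy b) := by
  wlog h : a < b generalizing a b
  · rcases (not_lt.mp h).eq_or_lt with rfl | h'
    · exact Commute.refl _
    · exact (this b a h').symm
  refine commute_of_mem_algOn (fun g hg => commute_jucysMurphy_of_lt hg)
    (algOn_mono ?_ (jucysMurphy_mem a))
  intro i hi
  exact Finset.mem_Iio.mpr ((Finset.mem_Iic.mp hi).trans_lt h)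

theorem commute_swap_jmPowerSum {n : ℕ} (i : Fin n) (r : ℕ) :
    Commute (δ (Equiv.swap i.castSucc i.succ)) (jmPowerSum (n + 1) r) := by
  set a := i.castSucc with ha
  set b := i.succ with hb
  have hab : a < b := Fin.castSucc_lt_succ
  have hav : (a : ℕ) = i := rfl
  have hbv : (b : ℕ) = i + 1 := rfl
  have hJ : δ (Equiv.swap a b) * jucysMurphy a = jucysMurphy b * δ (Equiv.swap a b) - 1 := by
    have hI : Finset.Iio b = insert a (Finset.Iio a) := by
      ext j
      simp only [Finset.mem_Iio, Finset.mem_insert, Fin.lt_def, Fin.ext_iff]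
      omega
    rw [jucysMurphy, jucysMurphy, hI, Finset.sum_insert (by simp), add_mul, ← map_mul,
      Equiv.swap_mul_self, map_one, add_sub_cancel_left, Finset.mul_sum, Finset.sum_mul]
    refine Finset.sum_congr rfl fun j hj => ?_
    have hj' := Finset.mem_Iio.mp hj
    rw [of_mul_swap, Equiv.swap_apply_left,
      Equiv.swap_apply_of_ne_of_ne hj'.ne (hj'.trans hab).ne]
  have hJ' : δ (Equiv.swap a b) * jucysMurphy b = jucysMurphy a * δ (Equiv.swap a b) + 1 := by
    have hss : δ (Equiv.swap a b) * δ (Equiv.swap a b) = (1 : SymAlg (n + 1)) := by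
      rw [← map_mul, Equiv.swap_mul_self, map_one]
    have h1 := congrArg (fun z => δ (Equiv.swap a b) * z * δ (Equiv.swap a b)) hJ
    simp only [← mul_assoc, mul_sub, sub_mul, hss, one_mul, mul_one] at h1
    rw [mul_assoc, hss, mul_one] at h1
    rw [h1]; abel
  rw [jmPowerSum, ← Finset.add_sum_erase _ _ (Finset.mem_univ a),
    ← Finset.add_sum_erase _ _ (Finset.mem_erase.mpr ⟨hab.ne', Finset.mem_univ b⟩), ← add_assoc]
  refine (commute_pow_add_pow hJ hJ' (commute_jucysMurphy_jucysMurphy a b) r).add_right ?_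
  refine Commute.sum_right _ _ _ fun k hk => Commute.pow_right ?_ r
  simp only [Finset.mem_erase, Finset.mem_univ, and_true] at hk
  -- For `k` other than `a` and `b`, both of these neighbours lie on the same side of `k`, so their
  -- swap preserves the entries below `k`.
  refine commute_jucysMurphy (Equiv.swap_apply_of_ne_of_ne hk.2 hk.1) fun j => ?_
  have h1 : (k : ℕ) ≠ i := fun h => hk.2 (Fin.ext (h.trans hav.symm))
  have h2 : (k : ℕ) ≠ i + 1 := fun h => hk.1 (Fin.ext (h.trans hbv.symm))
  rw [Equiv.swap_apply_def]
  split_ifs with h3 h4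
  · subst h3; simp only [Fin.lt_def]; omega
  · subst h4; simp only [Fin.lt_def]; omega
  · rfl

theorem jmPowerSum_central (d r : ℕ) (g : Equiv.Perm (Fin d)) :
    Commute (δ g) (jmPowerSum d r) := by
  rcases d with _ | n
  · rw [Subsingleton.elim g 1, map_one]; exact Commute.one_left _
  · have hg : g ∈ Submonoid.closure (Set.range fun i : Fin n => Equiv.swap i.castSucc i.succ) := by
      rw [Equiv.Perm.mclosure_swap_castSucc_succ]; trivial
    induction hg using Submonoid.closure_induction with
    | mem x hx => obtain ⟨i, rfl⟩ := hx; exact commute_swap_jmPowerSum i r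
    | one => rw [map_one]; exact Commute.one_left _
    | mul x y _ _ hx hy => rw [map_mul]; exact hx.mul_left hy

theorem youngCoeff_jmPowerSum (T : Tableau d lam) (r : ℕ) :
    youngCoeff T (jmPowerSum d r) = ∑ x ∈ lam.cells, ((x.2 : ℂ) - (x.1 : ℂ)) ^ r := by
  obtain ⟨g, hg⟩ := exists_isStandard T
  rw [← hg.youngCoeff_jmPowerSum, youngCoeff_trans T g (jmPowerSum_central d r)]

/-! ### The normalized trace -/

/-- The trace of an element of the group algebra on the Specht module, divided by the dimension. -/
def normTrace (T : Tableau d lam) : SymAlg d →ₗ[ℂ] ℂ :=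
  ((irrDim T : ℂ)⁻¹) • (LinearMap.trace ℂ (spechtModule T).toSubmodule ∘ₗ
    (spechtModule T).toRepresentation.asAlgebraHom.toLinearMap)

theorem normTrace_of (T : Tableau d lam) (g : Equiv.Perm (Fin d)) :
    normTrace T (δ g) = irrChar T g / irrDim T := by
  rw [normTrace, div_eq_inv_mul]
  simp [irrChar, Representation.character]

theorem normTrace_conj (T : Tableau d lam) (g h : Equiv.Perm (Fin d)) :
    normTrace T (δ (h * g * h⁻¹)) = normTrace T (δ g) := by
  rw [normTrace_of, normTrace_of, irrChar, Representation.char_conj]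

theorem coe_asAlgebraHom_spechtModule (T : Tableau d lam) (z : SymAlg d)
    (v : (spechtModule T).toSubmodule) :
    ((spechtModule T).toRepresentation.asAlgebraHom z v : SymAlg d) = z * v := by
  induction z using MonoidAlgebra.induction_on with
  | of g => rw [Representation.asAlgebraHom_of]; rfl
  | add f g hf hg => rw [map_add, LinearMap.add_apply, Submodule.coe_add, hf, hg, add_mul]
  | smul r f hf => rw [map_smul, LinearMap.smul_apply, Submodule.coe_smul, hf, smul_mul_assoc]

/-- On the left ideal generated by `c_T`, `z` acts by its scalar on `c_T`. The dimension cancels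
because `c_T` has identity coefficient `1`, so the ideal is nonzero. -/
theorem normTrace_of_central (T : Tableau d lam) {z : SymAlg d}
    (hz : ∀ g : Equiv.Perm (Fin d), Commute (δ g) z) : normTrace T z = youngCoeff T z := by
  have hfin : FiniteDimensional ℂ (SymAlg d) := inferInstance
  have hc : youngSymmetrizer T ≠ 0 := by
    intro h
    have h6 : coeffOne d (youngSymmetrizer T) = 1 := by
      rw [← one_mul (youngSymmetrizer T)]; exact youngCoeff_one T
    rw [h, map_zero] at h6
    exact zero_ne_one h6
  have hdim : (irrDim T : ℂ) ≠ 0 := by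
    rw [Nat.cast_ne_zero, irrDim]
    have : Nontrivial (spechtModule T).toSubmodule :=
      ⟨⟨⟨youngSymmetrizer T, 1, one_mul _⟩, 0, fun h => hc (congrArg Subtype.val h)⟩⟩
    exact Module.finrank_pos.ne'
  have hact : (spechtModule T).toRepresentation.asAlgebraHom z = youngCoeff T z • 1 := by
    ext1 v
    apply Subtype.ext
    rw [coe_asAlgebraHom_spechtModule]
    obtain ⟨_, x, rfl⟩ := v
    change z * (x * youngSymmetrizer T) = youngCoeff T z • (x * youngSymmetrizer T)
    rw [← mul_assoc, ← (commute_of_mem_algOn (fun g _ => hz g) (mem_algOn_univ x)).eq, mul_assoc,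
      mul_youngSymmetrizer_of_central T hz, mul_smul_comm]
  rw [normTrace, LinearMap.smul_apply, LinearMap.comp_apply, AlgHom.toLinearMap_apply, hact,
    map_smul, LinearMap.trace_one, smul_eq_mul, smul_eq_mul, mul_comm, mul_assoc]
  change youngCoeff T z * ((irrDim T : ℂ) * (irrDim T : ℂ)⁻¹) = _
  rw [mul_inv_cancel₀ hdim, mul_one]

theorem normTrace_mul_of_central (T : Tableau d lam) {z w : SymAlg d}
    (hz : ∀ g : Equiv.Perm (Fin d), Commute (δ g) z)
    (hw : ∀ g : Equiv.Perm (Fin d), Commute (δ g) w) :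
    normTrace T (z * w) = normTrace T z * normTrace T w := by
  rw [normTrace_of_central T hz, normTrace_of_central T hw,
    normTrace_of_central T fun g => (hz g).mul_right (hw g),
    (isSubdiagram_univ T).youngCoeff_mul (mem_algOn_univ z) (fun g _ => hz g) (mem_algOn_univ w)]

theorem normTrace_jmPowerSum (T : Tableau d lam) (r : ℕ) :
    normTrace T (jmPowerSum d r) = ∑ x ∈ lam.cells, ((x.2 : ℂ) - (x.1 : ℂ)) ^ r := by
  rw [normTrace_of_central T (jmPowerSum_central d r), youngCoeff_jmPowerSum]

theorem normTrace_one (T : Tableau d lam) : normTrace T 1 = 1 := by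
  rw [normTrace_of_central T fun g => Commute.one_right _, youngCoeff_one]

/-! ### Patterns and their placements -/

variable {α β γ : Type}

theorem viaEmbedding_eq {π : Equiv.Perm β} {h : β ↪ α} {σ : Equiv.Perm α}
    (h1 : ∀ x, σ (h x) = h (π x)) (h2 : ∀ y ∉ Set.range h, σ y = y) : π.viaEmbedding h = σ := by
  ext y
  by_cases hy : y ∈ Set.range h
  · obtain ⟨x, rfl⟩ := hy
    rw [Equiv.Perm.viaEmbedding_apply, h1]
  · rw [Equiv.Perm.viaEmbedding_apply_of_notMem _ _ _ hy, h2 y hy]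

theorem viaEmbedding_viaEmbedding (π : Equiv.Perm β) (h : β ↪ γ) (k : γ ↪ α) :
    (π.viaEmbedding h).viaEmbedding k = π.viaEmbedding (h.trans k) := by
  symm
  refine viaEmbedding_eq (fun x => ?_) fun y hy => ?_
  · rw [Function.Embedding.trans_apply, Equiv.Perm.viaEmbedding_apply,
      Equiv.Perm.viaEmbedding_apply, Function.Embedding.trans_apply]
  · by_cases hk : y ∈ Set.range k
    · obtain ⟨z, rfl⟩ := hk
      rw [Equiv.Perm.viaEmbedding_apply, Equiv.Perm.viaEmbedding_apply_of_notMem]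
      rintro ⟨x, rfl⟩
      exact hy ⟨x, rfl⟩
    · exact Equiv.Perm.viaEmbedding_apply_of_notMem _ _ _ hk

theorem viaEmbedding_trans_equiv (π : Equiv.Perm β) (h : β ↪ α) (g : Equiv.Perm α) :
    π.viaEmbedding (h.trans g.toEmbedding) = g * π.viaEmbedding h * g⁻¹ := by
  refine viaEmbedding_eq (fun x => ?_) fun y hy => ?_
  · simp [Equiv.Perm.viaEmbedding_apply]
  · have : g⁻¹ y ∉ Set.range h := by
      rintro ⟨x, hx⟩
      exact hy ⟨x, by simp [hx]⟩
    rw [Equiv.Perm.mul_apply, Equiv.Perm.mul_apply,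
      Equiv.Perm.viaEmbedding_apply_of_notMem _ _ _ this]
    simp

theorem viaEmbedding_swap [DecidableEq α] [DecidableEq β] (h : β ↪ α) (a b : β) :
    (Equiv.swap a b).viaEmbedding h = Equiv.swap (h a) (h b) := by
  refine viaEmbedding_eq (fun x => ?_) fun y hy => ?_
  · exact (h.injective.map_swap a b x).symm
  · exact Equiv.swap_apply_of_ne_of_ne (fun h' => hy ⟨a, h'.symm⟩) (fun h' => hy ⟨b, h'.symm⟩)

theorem viaEmbedding_mul (π ρ : Equiv.Perm β) (h : β ↪ α) :
    (π * ρ).viaEmbedding h = π.viaEmbedding h * ρ.viaEmbedding h :=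
  map_mul (Equiv.Perm.viaEmbeddingHom h) π ρ

/-- The sum of the permutations obtained by placing the pattern `π` on the entries in all
possible ways. -/
def patternSum (d : ℕ) (π : Equiv.Perm β) : SymAlg d :=
  ∑ᶠ h : β ↪ Fin d, δ (π.viaEmbedding h)

theorem patternSum_eq_sum [Fintype (β ↪ Fin d)] (π : Equiv.Perm β) :
    patternSum d π = ∑ h : β ↪ Fin d, δ (π.viaEmbedding h) :=
  finsum_eq_sum_of_fintype _

theorem patternSum_viaEmbedding (e : β ≃ γ) (π : Equiv.Perm β) :
    patternSum d (π.viaEmbedding e.toEmbedding) = patternSum d π := by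
  rw [patternSum, patternSum]
  exact finsum_eq_of_bijective (Equiv.embeddingCongr e.symm (Equiv.refl _))
    (Equiv.bijective _) fun h => by
      rw [viaEmbedding_viaEmbedding]
      rfl

theorem commute_patternSum [Finite β] (π : Equiv.Perm β) (g : Equiv.Perm (Fin d)) :
    Commute (δ g) (patternSum d π) := by
  have : Fintype (β ↪ Fin d) := Fintype.ofFinite _
  rw [patternSum_eq_sum, commute_iff_eq, Finset.mul_sum, Finset.sum_mul]
  refine Fintype.sum_equiv (Equiv.embeddingCongr (Equiv.refl β) g) _ _ fun h => ?_
  have h1 : Equiv.embeddingCongr (Equiv.refl β) g h = h.trans g.toEmbedding := rfl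
  rw [h1, viaEmbedding_trans_equiv, ← map_mul, ← map_mul, inv_mul_cancel_right]

/-- The tableaux of all shapes. -/
abbrev AnyTableau : Type := Σ (d : ℕ) (lam : YoungDiagram), Tableau d lam

/-- The normalized character of the sum of all placements of a pattern. -/
def patternChar (π : Equiv.Perm β) : AnyTableau → ℂ := fun t =>
  normTrace t.2.2 (patternSum t.1 π)

/-- The power sums of the contents. -/
def contentPowerSum (r : ℕ) : AnyTableau → ℂ := fun t =>
  ∑ x ∈ t.2.1.cells, ((x.2 : ℂ) - (x.1 : ℂ)) ^ r

theorem patternChar_viaEmbedding (e : β ≃ γ) (π : Equiv.Perm β) :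
    patternChar (π.viaEmbedding e.toEmbedding) = patternChar π := by
  funext t
  rw [patternChar, patternChar, patternSum_viaEmbedding]

theorem exists_perm_trans [Finite α] (h h' : β ↪ α) :
    ∃ g : Equiv.Perm α, h' = h.trans g.toEmbedding := by
  have := Finite.of_injective h h.injective
  obtain ⟨g, hg⟩ := Equiv.Perm.exists_extending_pair h h' h.injective h'.injective
  exact ⟨g, Function.Embedding.ext fun x => (hg x).symm⟩

/-- Any two placements of a pattern are conjugate in `S_d`. -/
theorem normTrace_viaEmbedding_eq (T : Tableau d lam) (π : Equiv.Perm β) (h h' : β ↪ Fin d) :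
    normTrace T (δ (π.viaEmbedding h)) = normTrace T (δ (π.viaEmbedding h')) := by
  obtain ⟨g, rfl⟩ := exists_perm_trans h h'
  rw [viaEmbedding_trans_equiv, normTrace_conj]

/-! ### Products of patterns, sorted by coincidences -/

instance finite_setoid [Finite α] : Finite (Setoid α) :=
  Finite.of_injective (fun s : Setoid α => s.r) fun _ _ h => Setoid.ext fun a b => by
    exact iff_of_eq (congrFun (congrFun h a) b)

instance fintypeSetoid [Finite α] : Fintype (Setoid α) := Fintype.ofFinite _

/-- Each genuine coincidence lowers the number of points, the quantity on which the main induction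
runs. -/
theorem card_quotient_lt [Finite β] {κ : Setoid β} (hκ : κ ≠ ⊥) :
    Nat.card (Quotient κ) < Nat.card β := by
  have hs : Function.Surjective (Quotient.mk κ) := Quotient.mk_surjective
  refine lt_of_le_of_ne (Nat.card_le_card_of_surjective _ hs) fun h => hκ ?_
  have hinj : Function.Injective (Quotient.mk κ) :=
    ((Nat.bijective_iff_surjective_and_card _).mpr ⟨hs, h.symm⟩).1
  exact le_bot_iff.mp fun a b hab => hinj (Quotient.sound hab)

/-- Maps with a prescribed kernel are the embeddings of the quotient. -/
theorem sum_ker_eq [Fintype α] [Fintype β] [DecidableEq β] {M : Type*} [AddCommMonoid M]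
    (κ : Setoid β)
    [DecidablePred fun f : β → α => Setoid.ker f = κ] [Fintype (Quotient κ ↪ α)]
    (F : (β → α) → M) :
    ∑ f with Setoid.ker f = κ, F f = ∑ h : Quotient κ ↪ α, F (h ∘ Quotient.mk κ) := by
  symm
  refine Finset.sum_bij (fun h _ => h ∘ Quotient.mk κ) ?_ ?_ ?_ fun _ _ => rfl
  · intro h _
    simp only [Finset.mem_filter, Finset.mem_univ, true_and]
    ext a b
    rw [Setoid.ker_def]
    simp only [Function.comp_apply, h.injective.eq_iff]
    exact Quotient.eq
  · intro h _ h' _ hh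
    ext q
    obtain ⟨a, rfl⟩ := Quotient.mk_surjective q
    exact congrFun hh a
  · intro f hf
    simp only [Finset.mem_filter, Finset.mem_univ, true_and] at hf
    subst hf
    exact ⟨⟨Setoid.kerLift f, Setoid.kerLift_injective f⟩, Finset.mem_univ _, rfl⟩

theorem sum_eq_sum_setoid [Fintype α] [Fintype β] [DecidableEq β] {M : Type*} [AddCommMonoid M]
    [∀ κ : Setoid β, Fintype (Quotient κ ↪ α)] (F : (β → α) → M) :
    ∑ f : β → α, F f = ∑ κ : Setoid β, ∑ h : Quotient κ ↪ α, F (h ∘ Quotient.mk κ) := by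
  classical
  rw [← Finset.sum_fiberwise (g := Setoid.ker)]
  exact Finset.sum_congr rfl fun κ _ => sum_ker_eq κ F

open Classical in
/-- The product of two pattern sums, ordered by the coincidences between the two patterns. -/
theorem patternSum_mul [Finite β] [Finite γ] (π : Equiv.Perm β) (ρ : Equiv.Perm γ) :
    patternSum d π * patternSum d ρ = ∑ κ : Setoid (β ⊕ γ),
      if H : Function.Injective (Quotient.mk κ ∘ Sum.inl) ∧
        Function.Injective (Quotient.mk κ ∘ Sum.inr) then
        patternSum d (π.viaEmbedding ⟨Quotient.mk κ ∘ Sum.inl, H.1⟩ *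
          ρ.viaEmbedding ⟨Quotient.mk κ ∘ Sum.inr, H.2⟩) else 0 := by
  have := Fintype.ofFinite β
  have := Fintype.ofFinite γ
  rw [patternSum_eq_sum, patternSum_eq_sum, Finset.sum_mul_sum, ← Finset.sum_product',
    ← Finset.sum_fiberwise (g := fun h : (β ↪ Fin d) × (γ ↪ Fin d) =>
      Setoid.ker (Sum.elim h.1 h.2))]
  refine Finset.sum_congr rfl fun κ _ => ?_
  split_ifs with H
  · rw [patternSum_eq_sum]
    symm
    let i : β ↪ Quotient κ := ⟨Quotient.mk κ ∘ Sum.inl, H.1⟩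
    let j : γ ↪ Quotient κ := ⟨Quotient.mk κ ∘ Sum.inr, H.2⟩
    have helim : ∀ k : Quotient κ ↪ Fin d,
        Sum.elim (i.trans k) (j.trans k) = k ∘ Quotient.mk κ := by
      intro k; ext x; cases x <;> rfl
    refine Finset.sum_bij (fun k _ => (i.trans k, j.trans k)) ?_ ?_ ?_ ?_
    · intro k _
      simp only [Finset.mem_filter, Finset.mem_product, Finset.mem_univ, true_and]
      ext a b
      rw [helim, Setoid.ker_def]
      simp only [Function.comp_apply, k.injective.eq_iff]
      exact Quotient.eq
    · intro k _ k' _ hk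
      ext q
      obtain ⟨a, rfl⟩ := Quotient.mk_surjective q
      have h1 : Sum.elim (i.trans k) (j.trans k) = Sum.elim (i.trans k') (j.trans k') :=
        congrArg (fun h : (β ↪ Fin d) × (γ ↪ Fin d) => Sum.elim h.1 h.2) hk
      rw [helim, helim] at h1
      exact congrArg Fin.val (congrFun h1 a)
    · rintro ⟨h, h'⟩ hh
      simp only [Finset.mem_filter, Finset.mem_product, Finset.mem_univ, true_and] at hh
      subst hh
      refine ⟨⟨Setoid.kerLift _, Setoid.kerLift_injective _⟩, Finset.mem_univ _, ?_⟩
      ext x <;> rfl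
    · intro k _
      rw [viaEmbedding_mul, viaEmbedding_viaEmbedding, viaEmbedding_viaEmbedding, map_mul]
  · refine Finset.sum_eq_zero fun h hh => absurd ?_ H
    simp only [Finset.mem_filter, Finset.mem_product, Finset.mem_univ, true_and] at hh
    subst hh
    refine ⟨fun a b hab => ?_, fun a b hab => ?_⟩
    · exact h.1.injective (Quotient.exact hab)
    · exact h.2.injective (Quotient.exact hab)

-- The right-hand side does not mention `d`, so this is an identity of functions on all tableaux at
-- once; it is the source of a polynomial independent of `d`.
open Classical in
theorem patternChar_mul [Finite β] [Finite γ] (π : Equiv.Perm β) (ρ : Equiv.Perm γ) :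
    patternChar π * patternChar ρ = ∑ κ : Setoid (β ⊕ γ),
      if H : Function.Injective (Quotient.mk κ ∘ Sum.inl) ∧
        Function.Injective (Quotient.mk κ ∘ Sum.inr) then
        patternChar (π.viaEmbedding ⟨Quotient.mk κ ∘ Sum.inl, H.1⟩ *
          ρ.viaEmbedding ⟨Quotient.mk κ ∘ Sum.inr, H.2⟩) else 0 := by
  funext t
  rw [Pi.mul_apply, patternChar, patternChar,
    ← normTrace_mul_of_central _ (commute_patternSum π) (commute_patternSum ρ), patternSum_mul,
    map_sum, Finset.sum_apply]
  refine Finset.sum_congr rfl fun κ _ => ?_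
  split_ifs
  · rfl
  · rw [map_zero]; rfl

/-- The quotient by the trivial relation. -/
def quotientBotEquiv (β : Type) : β ≃ Quotient (⊥ : Setoid β) :=
  Equiv.ofBijective (Quotient.mk ⊥)
    ⟨fun _ _ h => Quotient.exact h, Quotient.mk_surjective⟩

/-- The leading term of a product: without coincidences the two patterns sit side by side. -/
theorem patternChar_quotient_bot (π : Equiv.Perm β) (ρ : Equiv.Perm γ)
    (h1 : Function.Injective (Quotient.mk (⊥ : Setoid (β ⊕ γ)) ∘ Sum.inl))
    (h2 : Function.Injective (Quotient.mk (⊥ : Setoid (β ⊕ γ)) ∘ Sum.inr)) :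
    patternChar (π.viaEmbedding ⟨Quotient.mk (⊥ : Setoid (β ⊕ γ)) ∘ Sum.inl, h1⟩ *
      ρ.viaEmbedding ⟨Quotient.mk (⊥ : Setoid (β ⊕ γ)) ∘ Sum.inr, h2⟩) =
      patternChar (Equiv.sumCongr π ρ) := by
  rw [← patternChar_viaEmbedding (quotientBotEquiv (β ⊕ γ))]
  congr 1
  have e1 : (⟨Quotient.mk (⊥ : Setoid (β ⊕ γ)) ∘ Sum.inl, h1⟩ : β ↪ _) =
    Function.Embedding.inl.trans (quotientBotEquiv (β ⊕ γ)).toEmbedding := rfl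
  have e2 : (⟨Quotient.mk (⊥ : Setoid (β ⊕ γ)) ∘ Sum.inr, h2⟩ : γ ↪ _) =
    Function.Embedding.inr.trans (quotientBotEquiv (β ⊕ γ)).toEmbedding := rfl
  rw [e1, e2, ← viaEmbedding_viaEmbedding, ← viaEmbedding_viaEmbedding, ← viaEmbedding_mul]
  congr 1
  have hl : π.viaEmbedding (Function.Embedding.inl (α := β) (β := γ)) =
      Equiv.sumCongr π (Equiv.refl γ) := by
    refine viaEmbedding_eq (fun x => rfl) fun y hy => ?_
    rcases y with x | y
    · exact absurd ⟨x, rfl⟩ hy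
    · rfl
  have hr : ρ.viaEmbedding (Function.Embedding.inr (α := β) (β := γ)) =
      Equiv.sumCongr (Equiv.refl β) ρ := by
    refine viaEmbedding_eq (fun x => rfl) fun y hy => ?_
    rcases y with x | y
    · rfl
    · exact absurd ⟨y, rfl⟩ hy
  rw [hl, hr]
  ext x
  rcases x with x | x <;> rfl

/-! ### Content power sums as combinations of patterns -/

theorem sum_pow_eq_sum_ofFn {R : Type*} [Semiring R] [Fintype α] (x : α → R) (r : ℕ) :
    (∑ i, x i) ^ r = ∑ f : Fin r → α, (List.ofFn fun j => x (f j)).prod := by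
  classical
  induction r with
  | zero => simp
  | succ r ih =>
    rw [pow_succ', ih, Finset.sum_mul_sum, ← Finset.sum_product', Finset.univ_product_univ]
    refine Fintype.sum_equiv (Fin.consEquiv fun _ => α) _ _ fun p => ?_
    simp [List.ofFn_succ, Fin.consEquiv]

theorem prod_ofFn_ite {R : Type*} [Semiring R] {r : ℕ} (p : Fin r → Prop) [DecidablePred p]
    (y : Fin r → R) : (List.ofFn fun j => if p j then y j else 0).prod =
      if ∀ j, p j then (List.ofFn y).prod else 0 := by
  induction r with
  | zero => simp
  | succ r ih =>
    rw [List.ofFn_succ, List.prod_cons, ih, List.ofFn_succ, List.prod_cons]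
    simp only [Fin.forall_fin_succ]
    split_ifs <;> simp_all

open Classical in
/-- The product of the transpositions of the values of `f` with its base value. -/
def swapWord {r : ℕ} (f : Option (Fin r) → α) : Equiv.Perm α :=
  (List.ofFn fun i => Equiv.swap (f (some i)) (f none)).prod

theorem viaEmbedding_swapWord {r : ℕ} (f : Option (Fin r) → β) (h : β ↪ α) :
    (swapWord f).viaEmbedding h = swapWord (h ∘ f) := by
  classical
  have h1 : (swapWord f).viaEmbedding h = Equiv.Perm.viaEmbeddingHom h (swapWord f) := rfl
  rw [h1, swapWord, swapWord, map_list_prod, List.map_ofFn]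
  congr 2
  funext i
  exact viaEmbedding_swap h _ _

/-- `f none` is the index of the Jucys-Murphy element, and `f (some i)` is the smaller entry of the
`i`-th transposition in its power. -/
theorem jmPowerSum_eq (d r : ℕ) : jmPowerSum d r = ∑ f : Option (Fin r) → Fin d,
    if ∀ i, f (some i) < f none then δ (swapWord f) else 0 := by
  classical
  have h1 : ∀ k : Fin d, jucysMurphy k ^ r = ∑ f : Fin r → Fin d,
      if ∀ i, f i < k then (List.ofFn fun i => δ (Equiv.swap (f i) k)).prod else 0 := by
    intro k
    have h2 : jucysMurphy k = ∑ i, if i < k then δ (Equiv.swap i k) else 0 := by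
      rw [jucysMurphy, ← Finset.sum_filter]
      refine Finset.sum_congr ?_ fun _ _ => rfl
      ext i; simp
    rw [h2, sum_pow_eq_sum_ofFn]
    exact Finset.sum_congr rfl fun f _ => prod_ofFn_ite _ _
  rw [jmPowerSum, Finset.sum_congr rfl fun k _ => h1 k, ← Finset.sum_product',
    Finset.univ_product_univ]
  refine Fintype.sum_equiv (Equiv.piOptionEquivProd (β := fun _ : Option (Fin r) => Fin d)).symm
    _ _ fun p => ?_
  have h3 : δ (swapWord ((Equiv.piOptionEquivProd (β := fun _ : Option (Fin r) => Fin d)).symm p)) =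
      (List.ofFn fun i => δ (Equiv.swap (p.2 i) p.1)).prod := by
    rw [swapWord, map_list_prod, List.map_ofFn]
    congr 2
    funext i
    simp only [Function.comp_apply]
    congr! 2
  rw [h3]
  rfl

/-- Each point of a pattern is the largest one in the same proportion of placements. -/
theorem card_mul_sum_max [Fintype β] [DecidableEq β] [Fintype (β ↪ Fin d)] (b : β) (t : ℂ) :
    (Fintype.card β : ℂ) * ∑ h : β ↪ Fin d, (if ∀ x, x ≠ b → h x < h b then t else 0) =
      ∑ _h : β ↪ Fin d, t := by
  have h1 : ∀ c : β, ∑ h : β ↪ Fin d, (if ∀ x, x ≠ c → h x < h c then t else 0) =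
      ∑ h : β ↪ Fin d, (if ∀ x, x ≠ b → h x < h b then t else 0) := by
    intro c
    refine Fintype.sum_equiv (Equiv.embeddingCongr (Equiv.swap b c) (Equiv.refl _)) _ _ fun h => ?_
    have h2 : ∀ x, Equiv.embeddingCongr (Equiv.swap b c) (Equiv.refl (Fin d)) h x =
        h (Equiv.swap b c x) := fun x => by
      simp [Equiv.embeddingCongr]
    simp only [h2, Equiv.swap_apply_left]
    refine if_congr ⟨fun H x hx => H _ fun h' => hx ?_, fun H x hx => ?_⟩ rfl rfl
    · rw [← Equiv.swap_apply_self b c x, h', Equiv.swap_apply_right]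
    · have := H (Equiv.swap b c x) fun h' => hx (by
        rw [← Equiv.swap_apply_self b c x, h', Equiv.swap_apply_left])
      rwa [Equiv.swap_apply_self] at this
  have h2 : ∀ h : β ↪ Fin d, ∑ c : β, (if ∀ x, x ≠ c → h x < h c then t else 0) = t := by
    intro h
    obtain ⟨c, -, hc⟩ := Finset.exists_max_image Finset.univ h ⟨b, Finset.mem_univ b⟩
    rw [Finset.sum_eq_single c]
    · rw [if_pos]
      intro x hx
      exact lt_of_le_of_ne (hc x (Finset.mem_univ x)) fun h' => hx (h.injective h')
    · intro c' _ hc'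
      rw [if_neg]
      intro h'
      exact absurd (h' c hc'.symm) (not_lt.mpr (hc c' (Finset.mem_univ c')))
    · intro h'; exact absurd (Finset.mem_univ c) h'
  rw [← Finset.sum_congr rfl fun h _ => h2 h, Finset.sum_comm, Finset.sum_congr rfl fun c _ => h1 c,
    Finset.sum_const, nsmul_eq_mul, Finset.card_univ]

open Classical in
/-- The power sums of the contents in terms of pattern characters. -/
theorem contentPowerSum_eq (r : ℕ) : contentPowerSum r = ∑ κ : Setoid (Option (Fin r)),
    if ∀ i : Fin r, Quotient.mk κ (some i) ≠ Quotient.mk κ none then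
      ((Nat.card (Quotient κ) : ℚ)⁻¹) • patternChar (swapWord (Quotient.mk κ)) else 0 := by
  funext t
  obtain ⟨d, lam, T⟩ := t
  rw [contentPowerSum, Finset.sum_apply]
  dsimp only
  rw [← normTrace_jmPowerSum T, jmPowerSum_eq, sum_eq_sum_setoid, map_sum]
  refine Finset.sum_congr rfl fun κ _ => ?_
  rw [map_sum]
  split_ifs with hκ
  · rw [Pi.smul_apply, patternChar, patternSum_eq_sum, map_sum]
    dsimp only
    have hcond : ∀ h : Quotient κ ↪ Fin d,
        (∀ i, (h ∘ Quotient.mk κ) (some i) < (h ∘ Quotient.mk κ) none) ↔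
          ∀ x, x ≠ Quotient.mk κ none → h x < h (Quotient.mk κ none) := by
      intro h
      refine ⟨fun H x hx => ?_, fun H i => H _ (hκ i)⟩
      obtain ⟨a, rfl⟩ := Quotient.mk_surjective x
      rcases a with _ | i
      · exact absurd rfl hx
      · exact H i
    -- All placements have the same trace `s`, so the condition that the base point is largest just
    -- selects the fraction `1 / |Quotient κ|` of them. When no placement exists, any `s` serves.
    have hterm : ∃ s : ℂ, ∀ h : Quotient κ ↪ Fin d,
        normTrace T (δ ((swapWord (Quotient.mk κ)).viaEmbedding h)) = s := by
      by_cases hne : Nonempty (Quotient κ ↪ Fin d)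
      · exact ⟨_, fun h => normTrace_viaEmbedding_eq T _ h hne.some⟩
      · exact ⟨0, fun h => absurd ⟨h⟩ hne⟩
    obtain ⟨s, hs⟩ := hterm
    have hne : (Fintype.card (Quotient κ) : ℂ) ≠ 0 := by
      have : Nonempty (Quotient κ) := ⟨Quotient.mk κ none⟩
      exact Nat.cast_ne_zero.mpr Fintype.card_ne_zero
    rw [Finset.sum_congr rfl fun h _ => hs h, ← card_mul_sum_max (Quotient.mk κ none) s,
      Nat.card_eq_fintype_card, Rat.smul_def, Rat.cast_inv, Rat.cast_natCast,
      inv_mul_cancel_left₀ hne]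
    refine Finset.sum_congr rfl fun h _ => ?_
    simp only [hcond h]
    split_ifs
    · rw [← viaEmbedding_swapWord, hs]
    · rw [map_zero]
  · refine Finset.sum_eq_zero fun h _ => ?_
    push Not at hκ
    obtain ⟨i, hi⟩ := hκ
    rw [if_neg, map_zero]
    intro H
    have := H i
    rw [Function.comp_apply, Function.comp_apply, hi] at this
    exact lt_irrefl _ this

theorem patternChar_swapWord_bot (r : ℕ) :
    patternChar (swapWord (Quotient.mk (⊥ : Setoid (Option (Fin r))))) =
      patternChar (swapWord (id : Option (Fin r) → Option (Fin r))) := by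
  rw [← patternChar_viaEmbedding (quotientBotEquiv (Option (Fin r))), viaEmbedding_swapWord]
  rfl

/-! ### Induction on the number of points of a pattern -/

/-- The algebra generated by the first `n` power sums of the contents. -/
def contentAlg (n : ℕ) : Subalgebra ℚ (AnyTableau → ℂ) :=
  Algebra.adjoin ℚ (contentPowerSum '' Set.Iio n)

theorem contentAlg_mono {m n : ℕ} (h : m ≤ n) : contentAlg m ≤ contentAlg n :=
  Algebra.adjoin_mono (Set.image_mono (Set.Iio_subset_Iio h))

theorem contentPowerSum_mem {r n : ℕ} (h : r < n) : contentPowerSum r ∈ contentAlg n :=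
  Algebra.subset_adjoin ⟨r, h, rfl⟩

/-- Solve `contentPowerSum_eq` for its `⊥` term, whose coefficient is `1/(r+1)`; every other
quotient has fewer points. -/
theorem patternChar_swapWord_mem (r : ℕ)
    (ih : ∀ (β : Type) [Finite β], Nat.card β < r + 1 → ∀ π : Equiv.Perm β,
      patternChar π ∈ contentAlg (r + 1)) :
    patternChar (swapWord (id : Option (Fin r) → Option (Fin r))) ∈ contentAlg (r + 1) := by
  classical
  have h := contentPowerSum_eq r
  have hbot : ∀ i : Fin r, Quotient.mk (⊥ : Setoid (Option (Fin r))) (some i) ≠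
      Quotient.mk (⊥ : Setoid (Option (Fin r))) none := fun i hi =>
    absurd ((quotientBotEquiv (Option (Fin r))).injective hi) (by simp)
  rw [← Finset.add_sum_erase _ _ (Finset.mem_univ ⊥), if_pos hbot, patternChar_swapWord_bot] at h
  have hcard : Nat.card (Quotient (⊥ : Setoid (Option (Fin r)))) = r + 1 := by
    rw [← Nat.card_congr (quotientBotEquiv (Option (Fin r)))]; simp
  rw [hcard] at h
  have h2 := congrArg (fun F => ((r + 1 : ℕ) : ℚ) • F) (eq_sub_of_add_eq h.symm)
  beta_reduce at h2
  rw [smul_smul, mul_inv_cancel₀ (by positivity), one_smul] at h2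
  rw [h2]
  refine Subalgebra.smul_mem _ (sub_mem (contentPowerSum_mem (Nat.lt_succ_self r))
    (sum_mem fun κ hκ => ?_)) _
  split_ifs
  · refine Subalgebra.smul_mem _ (ih _ ?_ _) _
    have := card_quotient_lt (Finset.ne_of_mem_erase hκ)
    simpa using this
  · exact zero_mem _

theorem prod_map_swap_eq_formPerm [DecidableEq α] (x : α) (l : List α) (h : (x :: l).Nodup) :
    (l.map fun y => Equiv.swap y x).prod = (x :: l.reverse).formPerm := by
  induction l with
  | nil => simp
  | cons a l ih =>
    have h1 : (x :: l).Nodup := by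
      simp only [List.nodup_cons, List.mem_cons, not_or] at h ⊢; tauto
    -- The new swap prepends `a` to the cycle; one rotation moves it to the end, where the reversed
    -- list has it.
    rw [List.map_cons, List.prod_cons, ih h1, ← List.formPerm_cons_cons, ← List.formPerm_rotate_one]
    · simp
    · have : (a :: x :: l.reverse).Perm (x :: a :: l) :=
        (List.Perm.swap x a _).trans
          ((List.reverse_perm l).cons a |>.cons x)
      exact this.nodup_iff.mpr h

theorem swapWord_eq_formPerm [DecidableEq α] {r : ℕ} (f : Option (Fin r) → α)
    (hf : Function.Injective f) :
    swapWord f = (f none :: (List.ofFn fun i => f (some i)).reverse).formPerm := by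
  rw [← prod_map_swap_eq_formPerm, swapWord, List.map_ofFn]
  · congr 2
    funext i
    simp only [Function.comp_apply]
    congr!
  · rw [List.nodup_cons]
    refine ⟨?_, List.nodup_ofFn.mpr fun i j h => Option.some_injective _ (hf h)⟩
    rw [List.mem_ofFn]
    rintro ⟨i, hi⟩
    exact absurd (hf hi) (by simp)

theorem cycleType_swapWord [Fintype α] [DecidableEq α] {r : ℕ} (hr : 1 ≤ r)
    (f : Option (Fin r) → α) (hf : Function.Injective f) :
    (swapWord f).cycleType = {r + 1} := by
  have hnd : (f none :: (List.ofFn fun i => f (some i)).reverse).Nodup := by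
    rw [List.nodup_cons, List.nodup_reverse]
    refine ⟨?_, List.nodup_ofFn.mpr fun i j h => Option.some_injective _ (hf h)⟩
    rw [List.mem_reverse, List.mem_ofFn]
    rintro ⟨i, hi⟩
    exact absurd (hf hi) (by simp)
  rw [swapWord_eq_formPerm f hf, (List.isCycle_formPerm hnd (by simpa using hr)).cycleType,
    List.support_formPerm_of_nodup _ hnd, List.toFinset_card_of_nodup hnd]
  · simp
  · intro x hx
    have := congrArg List.length hx
    simp at this
    omega

theorem patternChar_conj (π g : Equiv.Perm β) : patternChar (g * π * g⁻¹) = patternChar π := by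
  have h : π.viaEmbedding (Function.Embedding.refl β) = π :=
    viaEmbedding_eq (fun _ => rfl) fun y hy => absurd ⟨y, rfl⟩ hy
  have h2 := viaEmbedding_trans_equiv π (Function.Embedding.refl β) g
  rw [h] at h2
  rw [← h2]
  exact patternChar_viaEmbedding g π

/-- The pattern character of a permutation with a single orbit. -/
theorem patternChar_eq_of_transitive [Finite β] {r : ℕ} (hcard : Nat.card β = r + 1)
    (π : Equiv.Perm β) (hπ : ∀ x y, π.SameCycle x y) :
    patternChar π = patternChar (swapWord (id : Option (Fin r) → Option (Fin r))) := by
  classical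
  have := Fintype.ofFinite β
  obtain ⟨e⟩ : Nonempty (Option (Fin r) ≃ β) := by
    rw [← Fintype.card_eq, ← Nat.card_eq_fintype_card (α := β), hcard]; simp
  rw [← patternChar_viaEmbedding e, viaEmbedding_swapWord]
  have hw : swapWord (e.toEmbedding ∘ (id : Option (Fin r) → Option (Fin r))) = swapWord e := rfl
  rw [hw]
  -- Cycle types do not record fixed points, so the one-point pattern is treated apart.
  rcases Nat.eq_zero_or_pos r with rfl | hr
  · have : Subsingleton β := e.symm.subsingleton
    rw [Subsingleton.elim π (swapWord e)]
  · have hcard' : Fintype.card β = r + 1 := by rw [← Nat.card_eq_fintype_card, hcard]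
    have hnt : (Set.univ : Set β).Nontrivial := by
      rw [Set.nontrivial_univ_iff, ← Fintype.one_lt_card_iff_nontrivial]; omega
    have hon : π.IsCycleOn Set.univ :=
      ⟨Set.bijOn_univ.mpr π.bijective, fun x _ y _ => hπ x y⟩
    have hne : ∀ x, π x ≠ x := fun x => hon.apply_ne hnt (Set.mem_univ x)
    have hcyc : π.IsCycle := ⟨e none, hne _, fun y _ => hπ _ y⟩
    have hsupp : π.support = Finset.univ :=
      Finset.eq_univ_of_forall fun x => Equiv.Perm.mem_support.mpr (hne x)
    have hconj : IsConj (swapWord e) π := by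
      rw [Equiv.Perm.isConj_iff_cycleType_eq, cycleType_swapWord hr e e.injective, hcyc.cycleType,
        hsupp, Finset.card_univ, hcard']
    obtain ⟨g, hg⟩ := isConj_iff.mp hconj
    rw [← hg, patternChar_conj]

/-- A permutation that preserves a subset is the disjoint union of its two restrictions. -/
theorem patternChar_sumCongr_subtypePerm (π : Equiv.Perm β) (p : β → Prop)
    (h : ∀ x, p (π x) ↔ p x) (h' : ∀ x, ¬ p (π x) ↔ ¬ p x) :
    patternChar (Equiv.sumCongr (π.subtypePerm h) (π.subtypePerm (p := fun x => ¬ p x) h')) = patternChar π := by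
  classical
  rw [← patternChar_viaEmbedding (Equiv.sumCompl p)]
  congr 1
  refine viaEmbedding_eq (fun x => ?_) fun y hy => ?_
  · rcases x with x | x <;> simp
  · exact absurd ((Equiv.sumCompl p).surjective y) hy

/-- The pattern characters are polynomials in the power sums of the contents. -/
theorem patternChar_mem_contentAlg (n : ℕ) : ∀ (β : Type) [Finite β], Nat.card β = n →
    ∀ π : Equiv.Perm β, patternChar π ∈ contentAlg n := by
  classical
  induction n using Nat.strong_induction_on with
  | _ n ih =>
  have ih' : ∀ (β : Type) [Finite β], Nat.card β < n → ∀ π : Equiv.Perm β,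
      patternChar π ∈ contentAlg n := fun β _ hβ π => contentAlg_mono hβ.le (ih _ hβ β rfl π)
  intro β _ hβ π
  rcases n with _ | r
  · have hempty : IsEmpty β := (Finite.card_eq_zero_iff).mp hβ
    -- The empty pattern has a single placement, the identity.
    have : patternChar π = 1 := by
      funext t
      rw [patternChar, patternSum_eq_sum, Fintype.sum_unique, Subsingleton.elim π 1]
      have h1 : (1 : Equiv.Perm β).viaEmbedding (default : β ↪ Fin t.1) = 1 :=
        map_one (Equiv.Perm.viaEmbeddingHom _)
      rw [h1, map_one, normTrace_one]
      rfl
    rw [this]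
    exact one_mem _
  by_cases htrans : ∀ x y, π.SameCycle x y
  · rw [patternChar_eq_of_transitive hβ π htrans]
    exact patternChar_swapWord_mem r ih'
  push Not at htrans
  -- The orbit of `x` misses `y` and its complement misses `x`, so both restrictions have fewer
  -- points. Their product has `π` as its leading term, and the remaining terms fall under the
  -- induction hypothesis.
  obtain ⟨x, y, hxy⟩ := htrans
  have hp : ∀ z, π.SameCycle x (π z) ↔ π.SameCycle x z := fun z =>
    Equiv.Perm.sameCycle_apply_right
  have hp' : ∀ z, ¬ π.SameCycle x (π z) ↔ ¬ π.SameCycle x z := fun z => not_congr (hp z)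
  rw [← patternChar_sumCongr_subtypePerm π _ hp hp']
  set π₁ := π.subtypePerm hp
  set π₂ := π.subtypePerm (p := fun z => ¬ π.SameCycle x z) hp'
  have hcard1 : Nat.card {z // π.SameCycle x z} < r + 1 := hβ ▸ Finite.card_subtype_lt hxy
  have hcard2 : Nat.card {z // ¬ π.SameCycle x z} < r + 1 :=
    hβ ▸ Finite.card_subtype_lt (x := x) (not_not.mpr (Equiv.Perm.SameCycle.refl π x))
  have hcard3 : Nat.card ({z // π.SameCycle x z} ⊕ {z // ¬ π.SameCycle x z}) = r + 1 := by
    rw [← hβ]; exact Nat.card_congr (Equiv.sumCompl _)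
  have hmul := patternChar_mul π₁ π₂
  have hbot : Function.Injective (Quotient.mk
        (⊥ : Setoid ({z // π.SameCycle x z} ⊕ {z // ¬ π.SameCycle x z})) ∘ Sum.inl) ∧
      Function.Injective (Quotient.mk
        (⊥ : Setoid ({z // π.SameCycle x z} ⊕ {z // ¬ π.SameCycle x z})) ∘ Sum.inr) :=
    ⟨(quotientBotEquiv _).injective.comp Sum.inl_injective,
      (quotientBotEquiv _).injective.comp Sum.inr_injective⟩
  rw [← Finset.add_sum_erase _ _ (Finset.mem_univ ⊥), dif_pos hbot, patternChar_quotient_bot]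
    at hmul
  rw [eq_sub_of_add_eq hmul.symm]
  refine sub_mem (mul_mem (ih' _ hcard1 _) (ih' _ hcard2 _)) (sum_mem fun κ hκ => ?_)
  split_ifs
  · exact ih' _ (hcard3 ▸ card_quotient_lt (Finset.ne_of_mem_erase hκ)) _
  · exact zero_mem _

/-! ### The class of an `m`-cycle -/

theorem mem_cycleClass_iff {d m : ℕ} (hm : 2 ≤ m) (σ : Equiv.Perm (Fin d)) :
    σ ∈ cycleClass d m ↔ σ.cycleType = {m} := by
  constructor
  · intro h
    have h1 : σ.partition.parts = m ::ₘ Multiset.replicate (d - m) 1 := h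
    have h2 : (Multiset.replicate (d - m) 1).filter (fun n => 2 ≤ n) = 0 :=
      Multiset.filter_eq_nil.mpr fun a ha => by rw [Multiset.eq_of_mem_replicate ha]; norm_num
    rw [← Equiv.Perm.filter_parts_partition_eq_cycleType, h1, Multiset.filter_cons_of_pos _ hm, h2]
    rfl
  · intro h
    have h1 : σ.support.card = m := by rw [← Equiv.Perm.sum_cycleType, h]; simp
    change σ.partition.parts = _
    rw [Equiv.Perm.parts_partition, h, h1, Fintype.card_fin]
    rfl

theorem centralChar_eq (T : Tableau d lam) {m : ℕ} {σ : Equiv.Perm (Fin d)}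
    (hσ : σ ∈ cycleClass d m) :
    centralChar T (cycleClass d m) = ((cycleClass d m).ncard : ℂ) * normTrace T (δ σ) := by
  rw [centralChar, valueOn_irrChar T _ isConj_of_mem_cycleClass σ hσ, normTrace_of, mul_div_assoc]

/-- The class is `{1}`. The pattern formula does not extend to this case: a one-point pattern has
`d` placements, all equal to the identity. -/
theorem centralChar_cycleClass_one (hd : 1 ≤ d) (T : Tableau d lam) :
    centralChar T (cycleClass d 1) = 1 := by
  have h1 : cycleClass d 1 = {1} := by
    ext σ
    rw [Set.mem_singleton_iff]
    constructor
    · intro h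
      have h1 : σ.partition.parts = 1 ::ₘ Multiset.replicate (d - 1) 1 := h
      have h2 : (1 ::ₘ Multiset.replicate (d - 1) 1).filter (fun n => 2 ≤ n) = 0 := by
        rw [← Multiset.replicate_succ]
        exact Multiset.filter_eq_nil.mpr fun a ha => by
          rw [Multiset.eq_of_mem_replicate ha]; norm_num
      rw [← Equiv.Perm.cycleType_eq_zero, ← Equiv.Perm.filter_parts_partition_eq_cycleType, h1, h2]
    · rintro rfl
      change (1 : Equiv.Perm (Fin d)).partition.parts = _
      rw [Equiv.Perm.parts_partition, ← Multiset.replicate_succ, Nat.sub_add_cancel hd]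
      simp
  rw [centralChar_eq T (σ := 1) (by rw [h1]; rfl), h1, map_one, normTrace_one]
  simp

/-- The central character of the class of a cycle is proportional to a pattern character. -/
theorem centralChar_cycleClass {r : ℕ} (hr : 1 ≤ r) (T : Tableau d lam) :
    centralChar T (cycleClass d (r + 1)) =
      (((r + 1 : ℕ) : ℚ)⁻¹ • patternChar (swapWord (id : Option (Fin r) → Option (Fin r))))
        ⟨d, lam, T⟩ := by
  classical
  have hmem := mem_cycleClass_iff (d := d) (m := r + 1) (by omega)
  rw [Pi.smul_apply, patternChar, patternSum_eq_sum, map_sum]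
  dsimp only
  have hmem' : ∀ h : Option (Fin r) ↪ Fin d, (swapWord id).viaEmbedding h ∈ cycleClass d (r + 1) :=
    fun h => by
      rw [hmem, viaEmbedding_swapWord]
      exact cycleType_swapWord hr _ h.injective
  by_cases hd : r + 1 ≤ d
  · have hne : Nonempty (Option (Fin r) ↪ Fin d) :=
      Function.Embedding.nonempty_of_card_le (by simpa using hd)
    obtain ⟨h₀⟩ := hne
    rw [centralChar_eq T (hmem' h₀), Finset.sum_congr rfl fun h _ =>
      normTrace_viaEmbedding_eq T (swapWord id) h h₀, Finset.sum_const, Finset.card_univ,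
      Fintype.card_embedding_eq]
    have hcard : (cycleClass d (r + 1)).ncard = r.factorial * d.choose (r + 1) := by
      have h1 : cycleClass d (r + 1) =
          ((Finset.univ.filter fun σ : Equiv.Perm (Fin d) => σ.cycleType = {r + 1} :
            Finset (Equiv.Perm (Fin d))) : Set (Equiv.Perm (Fin d))) := by
        ext σ; simp [hmem]
      rw [h1, Set.ncard_coe_finset]
      have := Equiv.Perm.card_of_cycleType_singleton (α := Fin d) (n := r + 1) (by omega)
        (by simpa using hd)
      simpa using this
    -- There are `(r+1)! * d.choose (r+1)` placements, which is `r+1` times the size of the class.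
    rw [hcard]
    simp only [Fintype.card_fin, Fintype.card_option, Nat.descFactorial_eq_factorial_mul_choose,
      Nat.factorial_succ, nsmul_eq_mul, Rat.smul_def]
    have h2 : ((r : ℂ) + 1) ≠ 0 := Nat.cast_add_one_ne_zero r
    push_cast
    field_simp
  -- For `d < r + 1` both sides vanish: there is no placement and the class is empty.
  · have hempty : IsEmpty (Option (Fin r) ↪ Fin d) :=
      Function.Embedding.isEmpty_of_card_lt (by simpa using hd)
    have h1 : cycleClass d (r + 1) = ∅ := by
      refine Set.eq_empty_of_forall_notMem fun σ hσ => hd ?_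
      have h2 := (hmem σ).mp hσ
      have h3 : σ.support.card = r + 1 := by rw [← Equiv.Perm.sum_cycleType, h2]; simp
      rw [← h3]
      simpa using Finset.card_le_univ σ.support
    rw [centralChar, h1]
    simp

/-! ### Shifted power sums and contents -/

theorem sum_cells_eq {M : Type*} [AddCommMonoid M] (lam : YoungDiagram) (g : ℕ × ℕ → M) :
    ∑ x ∈ lam.cells, g x =
      ∑ i ∈ Finset.range lam.card, ∑ j ∈ Finset.range (lam.rowLen i), g (i, j) := by
  have hmaps : ∀ x ∈ lam.cells, x.1 ∈ Finset.range lam.card := by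
    intro x hx
    rw [Finset.mem_range]
    have h1 : x.1 < lam.colLen x.2 := YoungDiagram.mem_iff_lt_colLen.mp hx
    refine h1.trans_le ?_
    rw [YoungDiagram.colLen_eq_card]
    exact Finset.card_le_card (Finset.filter_subset _ _)
  rw [← Finset.sum_fiberwise_of_maps_to hmaps]
  refine Finset.sum_congr rfl fun i _ => ?_
  have : lam.cells.filter (fun x => x.1 = i) = lam.row i := rfl
  rw [this, YoungDiagram.row_eq_prod, Finset.sum_product, Finset.sum_singleton]

/-- The shifted power sums in terms of the contents. -/
theorem shiftedPowerSum_eq (k : ℕ) (lam : YoungDiagram) : shiftedPowerSum k lam =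
    ∑ x ∈ lam.cells, ((((x.2 : ℚ) - x.1) + 1 / 2) ^ k - (((x.2 : ℚ) - x.1) + -1 / 2) ^ k) := by
  rw [sum_cells_eq, shiftedPowerSum]
  refine Finset.sum_congr rfl fun i _ => ?_
  -- The row contribution telescopes over its boxes; a box of content `c` gives the step from `c -
  -- 1/2` to `c + 1/2`.
  have h := Finset.sum_range_sub (fun j : ℕ => ((j : ℚ) - ((i : ℚ) + 1) + 1 / 2) ^ k) (lam.rowLen i)
  rw [Nat.cast_zero, zero_sub] at h
  rw [← h]
  refine Finset.sum_congr rfl fun j _ => ?_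
  push_cast
  ring

/-- In the binomial expansion the terms of degree `k + 1` cancel, and degree `k` keeps the
coefficient `(k + 1)(1/2 + 1/2)`. -/
theorem shiftedPowerSum_succ (k : ℕ) (lam : YoungDiagram) : shiftedPowerSum (k + 1) lam =
    (k + 1) * ∑ x ∈ lam.cells, ((x.2 : ℚ) - x.1) ^ k +
      ∑ j ∈ Finset.range k, (((1 / 2 : ℚ) ^ (k + 1 - j) - (-1 / 2 : ℚ) ^ (k + 1 - j)) *
        (k + 1).choose j) * ∑ x ∈ lam.cells, ((x.2 : ℚ) - x.1) ^ j := by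
  rw [shiftedPowerSum_eq]
  simp only [Finset.mul_sum]
  rw [Finset.sum_comm (s := Finset.range k), ← Finset.sum_add_distrib]
  refine Finset.sum_congr rfl fun x _ => ?_
  rw [add_pow, add_pow, ← Finset.sum_sub_distrib, Finset.sum_range_succ, Finset.sum_range_succ,
    Nat.choose_self, Nat.choose_succ_self_right, Nat.add_sub_cancel_left, Nat.sub_self]
  have h : ∀ j ∈ Finset.range k,
      ((x.2 : ℚ) - x.1) ^ j * (1 / 2) ^ (k + 1 - j) * ((k + 1).choose j : ℚ) -
        ((x.2 : ℚ) - x.1) ^ j * (-1 / 2) ^ (k + 1 - j) * ((k + 1).choose j : ℚ) =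
      ((1 / 2 : ℚ) ^ (k + 1 - j) - (-1 / 2 : ℚ) ^ (k + 1 - j)) * (k + 1).choose j *
        ((x.2 : ℚ) - x.1) ^ j := fun j _ => by ring
  rw [Finset.sum_congr rfl h]
  push_cast
  ring

/-- The shifted power sums as functions on tableaux. -/
def shiftedPowerFun (k : ℕ) : AnyTableau → ℂ := fun t => (shiftedPowerSum k t.2.1 : ℂ)

/-- `shiftedPowerSum_succ` is triangular with diagonal entries `r + 1`, which are invertible in `ℚ`;
the shift of index matches exponents below `m` with `p_1, …, p_m`. -/
theorem contentPowerSum_mem_range {m : ℕ} (r : ℕ) (hr : r < m) : contentPowerSum r ∈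
    (MvPolynomial.aeval (R := ℚ) fun k : Fin m => shiftedPowerFun ((k : ℕ) + 1)).range := by
  induction r using Nat.strong_induction_on with
  | _ r ih =>
  set A := (MvPolynomial.aeval (R := ℚ) fun k : Fin m => shiftedPowerFun ((k : ℕ) + 1)).range
  have hgen : shiftedPowerFun (r + 1) ∈ A :=
    ⟨MvPolynomial.X ⟨r, hr⟩, MvPolynomial.aeval_X _ _⟩
  have h1 : shiftedPowerFun (r + 1) = ((r : ℚ) + 1) • contentPowerSum r +
      ∑ j ∈ Finset.range r, (((1 / 2 : ℚ) ^ (r + 1 - j) - (-1 / 2 : ℚ) ^ (r + 1 - j)) *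
        (r + 1).choose j) • contentPowerSum j := by
    funext t
    rw [shiftedPowerFun, shiftedPowerSum_succ, Pi.add_apply, Finset.sum_apply]
    simp only [Pi.smul_apply, contentPowerSum, Rat.smul_def]
    push_cast
    rfl
  have hne : (r : ℚ) + 1 ≠ 0 := Nat.cast_add_one_ne_zero r
  have h2 : contentPowerSum r = ((r : ℚ) + 1)⁻¹ • (shiftedPowerFun (r + 1) -
      ∑ j ∈ Finset.range r, (((1 / 2 : ℚ) ^ (r + 1 - j) - (-1 / 2 : ℚ) ^ (r + 1 - j)) *
        (r + 1).choose j) • contentPowerSum j) := by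
    rw [h1, add_sub_cancel_right, smul_smul, inv_mul_cancel₀ hne, one_smul]
  rw [h2]
  refine Subalgebra.smul_mem _ (sub_mem hgen (sum_mem fun j hj => Subalgebra.smul_mem _ ?_ _)) _
  exact ih j (Finset.mem_range.mp hj) ((Finset.mem_range.mp hj).trans hr)

theorem contentAlg_le_range (m : ℕ) : contentAlg m ≤
    (MvPolynomial.aeval (R := ℚ) fun k : Fin m => shiftedPowerFun ((k : ℕ) + 1)).range := by
  refine Algebra.adjoin_le ?_
  rintro _ ⟨r, hr, rfl⟩
  exact contentPowerSum_mem_range r hr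

theorem aeval_shiftedPowerFun {m : ℕ} (φ : MvPolynomial (Fin m) ℚ) (t : AnyTableau) :
    MvPolynomial.aeval (fun k : Fin m => shiftedPowerFun ((k : ℕ) + 1)) φ t =
      ((MvPolynomial.eval (fun k : Fin m => shiftedPowerSum ((k : ℕ) + 1) t.2.1) φ : ℚ) : ℂ) := by
  induction φ using MvPolynomial.induction_on with
  | C a => rw [MvPolynomial.aeval_C, MvPolynomial.eval_C]; rfl
  | add p q hp hq => rw [map_add, map_add, Pi.add_apply, hp, hq, Rat.cast_add]
  | mul_X p k hp =>
    rw [map_mul, map_mul, Pi.mul_apply, hp, Rat.cast_mul, MvPolynomial.aeval_X,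
      MvPolynomial.eval_X]
    rfl

end SymChar

end

/-- For every `m ≥ 1` there is a polynomial `φ_m` in `m` variables over `ℚ`, independent of `d`,
with `f_lam(c^{(m)}) = φ_m(p_1(lam), …, p_m(lam))` for all `d ≥ 1` and all partitions `lam` of `d`;
the variable with index `k : Fin m` stands for `Y_{k+1}`. -/
theorem proposition1 (m : ℕ) (hm : 1 ≤ m) :
    ∃ φ : MvPolynomial (Fin m) ℚ,
      ∀ d : ℕ, 1 ≤ d → ∀ lam : YoungDiagram, lam.card = d → ∀ T : SymChar.Tableau d lam,
        SymChar.centralChar T (SymChar.cycleClass d m) =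
          ((MvPolynomial.eval
            (fun k : Fin m => SymChar.shiftedPowerSum ((k : ℕ) + 1) lam) φ : ℚ) : ℂ) := by
  rcases hm.eq_or_lt with rfl | hm
  · exact ⟨1, fun d hd lam _ T => by
      rw [SymChar.centralChar_cycleClass_one hd T, map_one, Rat.cast_one]⟩
  · obtain ⟨r, rfl⟩ : ∃ r, m = r + 1 := ⟨m - 1, by omega⟩
    have hmem := SymChar.contentAlg_le_range (r + 1) (Subalgebra.smul_mem _
      (SymChar.patternChar_mem_contentAlg (r + 1) (Option (Fin r)) (by simp)
        (SymChar.swapWord id)) ((r + 1 : ℕ) : ℚ)⁻¹)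
    obtain ⟨φ, hφ⟩ := hmem
    refine ⟨φ, fun d _ lam _ T => ?_⟩
    rw [SymChar.centralChar_cycleClass (by omega) T, ← hφ]
    exact SymChar.aeval_shiftedPowerFun φ ⟨d, lam, T⟩
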